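/- **Setting.** Let $d\in\{2,3\}$, let $\Omega\subset\mathbb R^d$ be a bounded Lipschitz domain with boundary $\Gamma$, and let $\varepsilon,\sigma,\delta,\kappa>0$. Write $H^1(\Gamma)$ for the Sobolev space with tangential gradient $\nabla_\Gamma$, $B:H^1(\Omega)\to H^{1/2}(\Gamma)$ for the trace operator, $Bu=u|_\Gamma$, $H^{-1/2}(\Gamma)$ for the dual of $H^{1/2}(\Gamma)$, and $$\langle K_\Omega u,v\rangle=\int_\Omega\nabla u\cdot\nabla v\,dx,\qquad \langle K_\Gamma p,q\rangle=\int_\Gamma\nabla_\Gamma p\cdot\nabla_\Gamma q\,dx .$$ Let $J,J_\Gamma\subseteq\mathbb R$ be open intervals (for instance $\mathbb R$), the domains of the potentials $W$ and $W_\Gamma$, and let $W=W_+-W_-$ on $J$ and $W_\Gamma=W_{\Gamma,+}-W_{\Gamma,-}$ on $J_\Gamma$ with $W_\pm$, $W_{\Gamma,\pm}$ convex and differentiable there. All functions $u$ (resp. $p$) below to which the potentials are applied take values in $J$ (resp. $J_\Gamma$) almost everywhere, and $W_\pm'(u)$ etc. are required to define functionals on $H^1(\Omega)$ (resp. $H^1(\Gamma)$)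 wherever they occur. The energy is $$E(u)=\int_\Omega \tfrac\varepsilon2|\nabla u|^2+\tfrac1\varepsilon W(u)\,dx+\int_\Gamma\tfrac{\delta\kappa}2|\nabla_\Gamma u|^2+\tfrac1\delta W_\Gamma(u)\,dx .$$ The weak (PDAE) formulation of the Cahn–Hilliard equation with Liu–Wu dynamic boundary conditions seeks $u,w:[0,T]\to H^1(\Omega)$, $p,w_\Gamma:[0,T]\to H^1(\Gamma)$, $\lambda:[0,T]\to H^{-1/2}(\Gamma)$ with $$\dot u+\sigma K_\Omega w=0,\quad \varepsilon K_\Omega u+\varepsilon^{-1}W'(u)-\varepsilon B^*\lambda=w\quad\text{in }H^1(\Omega)^*,$$ $$\dot p+K_\Gamma w_\Gamma=0,\quad \delta\kappa K_\Gamma p+\delta^{-1}W_\Gamma'(p)+\varepsilon\lambda=w_\Gamma\quad\text{in }H^1(\Gamma)^*,\qquad Bu-p=0 .$$ The first-order convex–concave splitting scheme with step size $\tau>0$ is, for $n\ge0$, $$u^{n+1}+\tau\sigma K_\Omega w^{n+1}=u^n,\quad \varepsilon K_\Omega u^{n+1}+\varepsilon^{-1}[W_+'(u^{n+1})-W_-'(u^n)]-\varepsilon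 B^*\lambda^{n+1}=w^{n+1}\quad\text{in }H^1(\Omega)^*,$$ $$p^{n+1}+\tau K_\Gamma w_\Gamma^{n+1}=p^n,\quad \delta\kappa K_\Gamma p^{n+1}+\delta^{-1}[W_{\Gamma,+}'(p^{n+1})-W_{\Gamma,-}'(p^n)]+\varepsilon\lambda^{n+1}=w_\Gamma^{n+1}\quad\text{in }H^1(\Gamma)^*,$$ $$Bu^{n+1}-p^{n+1}=0 .$$ **Proposition 3.2.** Let the initial data $u^0\in H^1(\Omega)$, $p^0\in H^1(\Gamma)$ be consistent, i.e. $p^0=u^0|_\Gamma$. (i) *Energy dissipation.* Let $\tau>0$ and $E(u^0)<\infty$. For every solution of the scheme and every $n\ge0$: $u^n|_\Gamma=p^n$, $E(u^n)$ is finite, and $E(u^{n+1})\le E(u^n)$. (ii) *First-order accuracy.* Assume in addition that $W_-'$ and $W_{\Gamma,-}'$ are Lipschitz continuous on $J$ and $J_\Gamma$. Let $T>0$ and let $(u,w,p,w_\Gamma,\lambda)$ be a solution on $[0,T]$ of the PDAE, satisfied for every $t\in[0,T]$, for which $u,p$ are Lipschitz in time with values in $L^2(\Omega),L^2(\Gamma)$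 and $w,w_\Gamma$ are Lipschitz in time with values in $H^1(\Omega),H^1(\Gamma)$. Then there is a constant $C$ such that for all $\tau>0$, all $N\in\mathbb N$ with $N\tau\le T$ and every solution $(u^n,w^n,p^n,w_\Gamma^n,\lambda^n)_{n\le N}$ of the scheme with $u^0=u(0)$, $p^0=p(0)$, $$\Big(\tau\sum_{n=1}^N\|u(n\tau)-u^n\|_{H^1(\Omega)}^2+\|p(n\tau)-p^n\|_{H^1(\Gamma)}^2\Big)^{1/2}\le C\tau,$$ $$\max_{0\le n\le N}\|u(n\tau)-u^n\|_{H^1(\Omega)^*}\le C\tau,\qquad \max_{0\le n\le N}\|p(n\tau)-p^n\|_{H^1(\Gamma)^*}\le C\tau .$$ -/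

import Mathlib

open MeasureTheory Set
open scoped ContDiff NNReal

noncomputable section

namespace CahnHilliard

/-! ### The domain and its boundary -/

/-- A bounded Lipschitz domain of `ℝᵈ`: open, connected, bounded, and near every boundary point
equal to the region strictly below the graph of a Lipschitz function over the hyperplane
orthogonal to some direction `e`. -/
structure IsBoundedLipschitzDomain {d : ℕ} (Ω : Set (EuclideanSpace ℝ (Fin d))) : Prop where
  isOpen : IsOpen Ω
  isConnected : IsConnected Ω
  isBounded : Bornology.IsBounded Ω
  locally_subgraph : ∀ x ∈ frontier Ω, ∃ e : EuclideanSpace ℝ (Fin d), ‖e‖ = 1 ∧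
    ∃ r > 0, ∃ (K : ℝ≥0) (γ : EuclideanSpace ℝ (Fin d) → ℝ), LipschitzWith K γ ∧
      ∀ y ∈ Metric.ball x r, y ∈ Ω ↔ inner ℝ y e < γ (y - inner ℝ y e • e)

variable {d : ℕ} (Ω : Set (EuclideanSpace ℝ (Fin d)))

/-- The surface measure on `Γ = ∂Ω`: the `(d-1)`-dimensional Hausdorff measure, normalised so that
it agrees with Lebesgue measure on hyperplanes. -/
def surfaceMeasure : Measure (EuclideanSpace ℝ (Fin d)) :=
  (Measure.euclideanHausdorffMeasure (d - 1)).restrict (frontier Ω)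

/-- The tangent space `T_xΓ`. At every boundary point where the local graph is
differentiable (so almost everywhere) this is the tangent hyperplane. -/
def tangentSpaceAt (x : EuclideanSpace ℝ (Fin d)) : Submodule ℝ (EuclideanSpace ℝ (Fin d)) :=
  Submodule.span ℝ (tangentConeAt ℝ (frontier Ω) x)

/-- The tangential gradient `∇_Γ φ` of (the restriction to `Γ` of) a smooth function `φ` on `ℝᵈ`:
the orthogonal projection of `∇φ` to the tangent space. -/
def surfaceGradient (φ : EuclideanSpace ℝ (Fin d) → ℝ) (x : EuclideanSpace ℝ (Fin d)) :
    EuclideanSpace ℝ (Fin d) :=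
  (tangentSpaceAt Ω x).starProjection (gradient φ x)

/-! ### Function spaces -/

/-- `L²(Ω)`. -/
abbrev L2Bulk : Type := Lp ℝ 2 (volume.restrict Ω)

/-- `L²(Γ)`. -/
abbrev L2Surf : Type := Lp ℝ 2 (surfaceMeasure Ω)

theorem integrable_mul_test {u : EuclideanSpace ℝ (Fin d) → ℝ}
    {ψ : EuclideanSpace ℝ (Fin d) → EuclideanSpace ℝ (Fin d)}
    (hu : MemLp u 2 (volume.restrict Ω)) (hψ : Continuous ψ) (hc : HasCompactSupport ψ) :
    Integrable (fun x => u x • ψ x) (volume.restrict Ω) := by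
  have h2 : MemLp ψ 2 (volume.restrict Ω) := (hψ.memLp_of_hasCompactSupport hc).restrict _
  exact memLp_one_iff_integrable.1 (h2.smul hu)

theorem integrable_test_mul {G : EuclideanSpace ℝ (Fin d) → EuclideanSpace ℝ (Fin d)}
    {φ : EuclideanSpace ℝ (Fin d) → ℝ}
    (hG : MemLp G 2 (volume.restrict Ω)) (hφ : Continuous φ) (hc : HasCompactSupport φ) :
    Integrable (fun x => φ x • G x) (volume.restrict Ω) := by
  have h2 : MemLp φ 2 (volume.restrict Ω) := (hφ.memLp_of_hasCompactSupport hc).restrict _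
  exact memLp_one_iff_integrable.1 (hG.smul h2)

theorem continuous_gradient_test {φ : EuclideanSpace ℝ (Fin d) → ℝ} (hφ : ContDiff ℝ ∞ φ) :
    Continuous (gradient φ) :=
  (InnerProductSpace.toDual ℝ (EuclideanSpace ℝ (Fin d))).symm.continuous.comp
    (hφ.continuous_fderiv (by simp))

theorem hasCompactSupport_gradient {φ : EuclideanSpace ℝ (Fin d) → ℝ} (hc : HasCompactSupport φ) :
    HasCompactSupport (gradient φ) :=
  (hc.fderiv (𝕜 := ℝ)).comp_left (map_zero _)

/-- `H¹(Ω)`, as the space of the pairs `(u, ∇u)` with `u ∈ L²(Ω)` and weak gradient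
`∇u ∈ L²(Ω; ℝᵈ)`. Its norm is the usual one, `‖u‖² = ‖u‖²_{L²} + ‖∇u‖²_{L²}`. -/
def H1Bulk : Submodule ℝ (WithLp 2 (L2Bulk Ω × Lp (EuclideanSpace ℝ (Fin d)) 2 (volume.restrict Ω)))
    where
  carrier := {f | ∀ φ : EuclideanSpace ℝ (Fin d) → ℝ, ContDiff ℝ ∞ φ → HasCompactSupport φ →
    tsupport φ ⊆ Ω → ∫ x in Ω, f.fst x • gradient φ x = -∫ x in Ω, φ x • f.snd x}
  add_mem' := by
    intro f g hf hg φ h1 h2 h3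
    have e1 : ∫ x in Ω, (f + g).fst x • gradient φ x
        = ∫ x in Ω, (f.fst x • gradient φ x + g.fst x • gradient φ x) := by
      refine integral_congr_ae ?_
      filter_upwards [Lp.coeFn_add f.fst g.fst] with x hx
      rw [WithLp.add_fst, hx, Pi.add_apply, add_smul]
    have e2 : ∫ x in Ω, φ x • (f + g).snd x = ∫ x in Ω, (φ x • f.snd x + φ x • g.snd x) := by
      refine integral_congr_ae ?_
      filter_upwards [Lp.coeFn_add f.snd g.snd] with x hx
      rw [WithLp.add_snd, hx, Pi.add_apply, smul_add]
    have c := continuous_gradient_test h1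
    have s := hasCompactSupport_gradient h2
    rw [e1, e2, integral_add (integrable_mul_test Ω (Lp.memLp _) c s)
        (integrable_mul_test Ω (Lp.memLp _) c s),
      integral_add (integrable_test_mul Ω (Lp.memLp _) h1.continuous h2)
        (integrable_test_mul Ω (Lp.memLp _) h1.continuous h2), hf φ h1 h2 h3, hg φ h1 h2 h3, neg_add]
  zero_mem' := by
    intro φ h1 h2 h3
    have e1 : ∫ x in Ω, (0 : L2Bulk Ω) x • gradient φ x = 0 := by
      refine (integral_congr_ae (g := fun _ => 0) ?_).trans (by simp)
      filter_upwards [Lp.coeFn_zero ℝ 2 (volume.restrict Ω)] with x hx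
      rw [hx, Pi.zero_apply, zero_smul]
    have e2 : ∫ x in Ω, φ x • (0 : Lp (EuclideanSpace ℝ (Fin d)) 2 (volume.restrict Ω)) x = 0 := by
      refine (integral_congr_ae (g := fun _ => 0) ?_).trans (by simp)
      filter_upwards [Lp.coeFn_zero (EuclideanSpace ℝ (Fin d)) 2 (volume.restrict Ω)] with x hx
      rw [hx, Pi.zero_apply, smul_zero]
    rw [WithLp.zero_fst, WithLp.zero_snd, e1, e2, neg_zero]
  smul_mem' := by
    intro c f hf φ h1 h2 h3
    have e1 : ∫ x in Ω, (c • f).fst x • gradient φ x = c • ∫ x in Ω, f.fst x • gradient φ x := by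
      rw [← integral_smul]
      refine integral_congr_ae ?_
      filter_upwards [Lp.coeFn_smul c f.fst] with x hx
      rw [WithLp.smul_fst, hx, Pi.smul_apply, smul_assoc]
    have e2 : ∫ x in Ω, φ x • (c • f).snd x = c • ∫ x in Ω, φ x • f.snd x := by
      rw [← integral_smul]
      refine integral_congr_ae ?_
      filter_upwards [Lp.coeFn_smul c f.snd] with x hx
      rw [WithLp.smul_snd, hx, Pi.smul_apply, smul_comm]
    rw [e1, e2, hf φ h1 h2 h3, smul_neg]

/-- `H¹(Γ)`, as the space of the pairs `(p, ∇_Γ p)`: the closure, in `L²(Γ) × L²(Γ; ℝᵈ)`, of the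
pairs `(φ|_Γ, ∇_Γ φ)` with `φ ∈ C_c^∞(ℝᵈ)`. Its norm is the usual one,
`‖p‖² = ‖p‖²_{L²(Γ)} + ‖∇_Γ p‖²_{L²(Γ)}`. -/
def H1Surf :
    Submodule ℝ (WithLp 2 (L2Surf Ω × Lp (EuclideanSpace ℝ (Fin d)) 2 (surfaceMeasure Ω))) :=
  (Submodule.span ℝ {f | ∃ φ : EuclideanSpace ℝ (Fin d) → ℝ, ContDiff ℝ ∞ φ ∧
    HasCompactSupport φ ∧ f.fst =ᵐ[surfaceMeasure Ω] φ ∧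
    f.snd =ᵐ[surfaceMeasure Ω] surfaceGradient Ω φ}).topologicalClosure

variable {Ω}

/-- The function `u ∈ L²(Ω)` underlying `u ∈ H¹(Ω)`. -/
def bulkVal (u : H1Bulk Ω) : L2Bulk Ω := u.1.fst

/-- The weak gradient `∇u` of `u ∈ H¹(Ω)`. -/
def bulkGrad (u : H1Bulk Ω) : Lp (EuclideanSpace ℝ (Fin d)) 2 (volume.restrict Ω) :=
  u.1.snd

/-- The function `p ∈ L²(Γ)` underlying `p ∈ H¹(Γ)`. -/
def surfVal (p : H1Surf Ω) : L2Surf Ω := p.1.fst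

/-- The tangential gradient `∇_Γ p` of `p ∈ H¹(Γ)`. -/
def surfGrad (p : H1Surf Ω) : Lp (EuclideanSpace ℝ (Fin d)) 2 (surfaceMeasure Ω) :=
  p.1.snd

variable (Ω)

/-- The graph of the trace operator `B`, as the closure in `H¹(Ω) × L²(Γ)` of the pairs
`(φ|_Ω, φ|_Γ)` with `φ ∈ C_c^∞(ℝᵈ)`; on a bounded Lipschitz domain this is the usual trace,
defined on all of `H¹(Ω)`. -/
def traceGraph : Submodule ℝ (H1Bulk Ω × L2Surf Ω) :=
  (Submodule.span ℝ {z | ∃ φ : EuclideanSpace ℝ (Fin d) → ℝ, ContDiff ℝ ∞ φ ∧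
    HasCompactSupport φ ∧ bulkVal z.1 =ᵐ[volume.restrict Ω] φ ∧
    z.2 =ᵐ[surfaceMeasure Ω] φ}).topologicalClosure

variable {Ω} in
/-- `B u = g`, that is, `u|_Γ = g`. -/
def IsTrace (u : H1Bulk Ω) (g : L2Surf Ω) : Prop := (u, g) ∈ traceGraph Ω

/-- `H^{1/2}(Γ)`, the space of the traces of the functions in `H¹(Ω)`. -/
def HHalf : Submodule ℝ (L2Surf Ω) := (traceGraph Ω).map (LinearMap.snd ℝ (H1Bulk Ω) (L2Surf Ω))

/-- `H^{-1/2}(Γ)`, the dual of `H^{1/2}(Γ)`: the linear functionals that are bounded for the trace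
norm `‖g‖ = inf {‖v‖_{H¹(Ω)} : B v = g}`. -/
structure HMinusHalf where
  toLin : HHalf Ω →ₗ[ℝ] ℝ
  bounded : ∃ C : ℝ, ∀ (v : H1Bulk Ω) (g : HHalf Ω), IsTrace v (g : L2Surf Ω) →
    |toLin g| ≤ C * ‖v‖

variable {Ω}

/-- `(u, v)_{L²(Ω)}`. -/
def ipBulk (u v : H1Bulk Ω) : ℝ := ∫ x in Ω, bulkVal u x * bulkVal v x

/-- `(p, q)_{L²(Γ)}`. -/
def ipSurf (p q : H1Surf Ω) : ℝ := ∫ x, surfVal p x * surfVal q x ∂surfaceMeasure Ω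

/-- `⟨K_Ω u, v⟩ = ∫_Ω ∇u · ∇v`. -/
def KBulk (u v : H1Bulk Ω) : ℝ := ∫ x in Ω, inner ℝ (bulkGrad u x) (bulkGrad v x)

/-- `⟨K_Γ p, q⟩ = ∫_Γ ∇_Γ p · ∇_Γ q`. -/
def KSurf (p q : H1Surf Ω) : ℝ := ∫ x, inner ℝ (surfGrad p x) (surfGrad q x) ∂surfaceMeasure Ω

/-- `f(u)` defines a functional on `H¹(Ω)`, namely `v ↦ ∫_Ω f(u) v`: all of these integrals
exist. (The functional is then automatically bounded.) -/
def InDualBulk (f : ℝ → ℝ) (u : H1Bulk Ω) : Prop :=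
  ∀ v : H1Bulk Ω, Integrable (fun x => f (bulkVal u x) * bulkVal v x) (volume.restrict Ω)

/-- `⟨f(u), v⟩ = ∫_Ω f(u) v`. -/
def nlBulk (f : ℝ → ℝ) (u v : H1Bulk Ω) : ℝ := ∫ x in Ω, f (bulkVal u x) * bulkVal v x

/-- `f(p)` defines a functional on `H¹(Γ)`, namely `q ↦ ∫_Γ f(p) q`. -/
def InDualSurf (f : ℝ → ℝ) (p : H1Surf Ω) : Prop :=
  ∀ q : H1Surf Ω, Integrable (fun x => f (surfVal p x) * surfVal q x) (surfaceMeasure Ω)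

/-- `⟨f(p), q⟩ = ∫_Γ f(p) q`. -/
def nlSurf (f : ℝ → ℝ) (p q : H1Surf Ω) : ℝ := ∫ x, f (surfVal p x) * surfVal q x ∂surfaceMeasure Ω

/-! ### The model -/

/-- `f = f₊ - f₋` on the open interval `J`, with `f₊ = fp` and `f₋ = fm` convex and
differentiable on `J`. -/
structure IsConvexConcaveSplitting (J : Set ℝ) (f fp fm : ℝ → ℝ) : Prop where
  isOpen : IsOpen J
  convex_plus : ConvexOn ℝ J fp
  convex_minus : ConvexOn ℝ J fm
  differentiable_plus : DifferentiableOn ℝ fp J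
  differentiable_minus : DifferentiableOn ℝ fm J
  eq_sub : ∀ x ∈ J, f x = fp x - fm x

/-- The data of the model: the domain `Ω`, the parameters `ε, σ, δ, κ`, the potentials `W` and `W_Γ`
(defined on the intervals `J` and `JΓ`), and their splittings `W = Wp - Wm`, `W_Γ = WΓp - WΓm`. -/
structure Model (d : ℕ) where
  Ω : Set (EuclideanSpace ℝ (Fin d))
  ε : ℝ
  σ : ℝ
  δ : ℝ
  κ : ℝ
  J : Set ℝ
  W : ℝ → ℝ
  Wp : ℝ → ℝ
  Wm : ℝ → ℝ
  JΓ : Set ℝ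
  WΓ : ℝ → ℝ
  WΓp : ℝ → ℝ
  WΓm : ℝ → ℝ

/-- The standing assumptions on the data. -/
structure Model.Admissible (M : Model d) : Prop where
  domain : IsBoundedLipschitzDomain M.Ω
  ε_pos : 0 < M.ε
  σ_pos : 0 < M.σ
  δ_pos : 0 < M.δ
  κ_pos : 0 < M.κ
  splitting : IsConvexConcaveSplitting M.J M.W M.Wp M.Wm
  splittingΓ : IsConvexConcaveSplitting M.JΓ M.WΓ M.WΓp M.WΓm

variable (M : Model d)

/-- The values of `u` lie in the domain of `W`, those of `p` in the domain of `W_Γ`. -/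
def Model.InRange (u : H1Bulk M.Ω) (p : H1Surf M.Ω) : Prop :=
  (∀ᵐ x ∂(volume.restrict M.Ω), bulkVal u x ∈ M.J) ∧ ∀ᵐ x ∂(surfaceMeasure M.Ω), surfVal p x ∈ M.JΓ

/-- `E_bulk(u)`. -/
def Model.energyBulk (u : H1Bulk M.Ω) : ℝ :=
  ∫ x in M.Ω, (M.ε / 2 * inner ℝ (bulkGrad u x) (bulkGrad u x) + 1 / M.ε * M.W (bulkVal u x))

/-- `E_surf`, as a function of `p = u|_Γ`. -/
def Model.energySurf (p : H1Surf M.Ω) : ℝ :=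
  ∫ x, (M.δ * M.κ / 2 * inner ℝ (surfGrad p x) (surfGrad p x) + 1 / M.δ * M.WΓ (surfVal p x))
    ∂(surfaceMeasure M.Ω)

/-- The total energy `E(u) = E_bulk(u) + E_surf(u|_Γ)`, with `p = u|_Γ`. -/
def Model.energy (u : H1Bulk M.Ω) (p : H1Surf M.Ω) : ℝ := M.energyBulk u + M.energySurf p

/-- The potential parts of the energy are integrable, that is, `E(u)` is defined and finite. -/
def Model.FiniteEnergy (u : H1Bulk M.Ω) (p : H1Surf M.Ω) : Prop :=
  Integrable (fun x => M.W (bulkVal u x)) (volume.restrict M.Ω) ∧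
    Integrable (fun x => M.WΓ (surfVal p x)) (surfaceMeasure M.Ω)

/-- One step, from `(u₀, p₀)` to `(u₁, w₁, p₁, r₁, l₁)`, of the first-order convex-concave
splitting scheme with step size `τ` for the Liu-Wu model; `r` is the boundary chemical potential
`w_Γ` and `l` the Lagrange multiplier `λ`. -/
structure Model.LiuWuStep (τ : ℝ) (u₀ : H1Bulk M.Ω) (p₀ : H1Surf M.Ω)
    (u₁ w₁ : H1Bulk M.Ω) (p₁ r₁ : H1Surf M.Ω) (l₁ : HMinusHalf M.Ω) : Prop where
  dual_plus : InDualBulk (deriv M.Wp) u₁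
  dual_minus : InDualBulk (deriv M.Wm) u₀
  dualΓ_plus : InDualSurf (deriv M.WΓp) p₁
  dualΓ_minus : InDualSurf (deriv M.WΓm) p₀
  /- `u₁ + τ σ K_Ω w₁ = u₀` in `H¹(Ω)*` -/
  eq_a : ∀ v : H1Bulk M.Ω, ipBulk u₁ v + τ * M.σ * KBulk w₁ v = ipBulk u₀ v
  /- `ε K_Ω u₁ + ε⁻¹ [W₊'(u₁) - W₋'(u₀)] - ε B* l₁ = w₁` in `H¹(Ω)*` -/
  eq_b : ∀ (v : H1Bulk M.Ω) (g : HHalf M.Ω), IsTrace v (g : L2Surf M.Ω) →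
    M.ε * KBulk u₁ v + M.ε⁻¹ * (nlBulk (deriv M.Wp) u₁ v - nlBulk (deriv M.Wm) u₀ v)
      - M.ε * l₁.toLin g = ipBulk w₁ v
  /- `p₁ + τ K_Γ r₁ = p₀` in `H¹(Γ)*` -/
  eq_c : ∀ q : H1Surf M.Ω, ipSurf p₁ q + τ * KSurf r₁ q = ipSurf p₀ q
  /- `δ κ K_Γ p₁ + δ⁻¹ [W_Γ₊'(p₁) - W_Γ₋'(p₀)] + ε l₁ = r₁` in `H¹(Γ)*`; here `g` is `q` as an
  element of `H^{1/2}(Γ) ⊇ H¹(Γ)` -/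
  eq_d : ∀ (q : H1Surf M.Ω) (g : HHalf M.Ω), (g : L2Surf M.Ω) = surfVal q →
    M.δ * M.κ * KSurf p₁ q + M.δ⁻¹ * (nlSurf (deriv M.WΓp) p₁ q - nlSurf (deriv M.WΓm) p₀ q)
      + M.ε * l₁.toLin g = ipSurf r₁ q
  /- `B u₁ - p₁ = 0` -/
  eq_e : IsTrace u₁ (surfVal p₁)

/-- `(u, w, p, r, l)` is a solution on `[0, T]` of the weak (PDAE) formulation of the Cahn-Hilliard
equation with Liu-Wu dynamic boundary conditions; `r = w_Γ` and `l = λ`. The time derivatives are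
taken in the duals of `H¹(Ω)` and `H¹(Γ)`, tested against each element. -/
structure Model.LiuWuSolution (T : ℝ) (u w : ℝ → H1Bulk M.Ω) (p r : ℝ → H1Surf M.Ω)
    (l : ℝ → HMinusHalf M.Ω) : Prop where
  inRange : ∀ t ∈ Icc 0 T, M.InRange (u t) (p t)
  dual : ∀ t ∈ Icc 0 T, InDualBulk (deriv M.W) (u t)
  dualΓ : ∀ t ∈ Icc 0 T, InDualSurf (deriv M.WΓ) (p t)
  /- `u̇ + σ K_Ω w = 0` in `H¹(Ω)*` -/
  eq_a : ∀ t ∈ Icc 0 T, ∀ v : H1Bulk M.Ω,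
    HasDerivWithinAt (fun s => ipBulk (u s) v) (-(M.σ * KBulk (w t) v)) (Icc 0 T) t
  /- `ε K_Ω u + ε⁻¹ W'(u) - ε B* l = w` in `H¹(Ω)*` -/
  eq_b : ∀ t ∈ Icc 0 T, ∀ (v : H1Bulk M.Ω) (g : HHalf M.Ω), IsTrace v (g : L2Surf M.Ω) →
    M.ε * KBulk (u t) v + M.ε⁻¹ * nlBulk (deriv M.W) (u t) v - M.ε * (l t).toLin g
      = ipBulk (w t) v
  /- `ṗ + K_Γ r = 0` in `H¹(Γ)*` -/
  eq_c : ∀ t ∈ Icc 0 T, ∀ q : H1Surf M.Ω,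
    HasDerivWithinAt (fun s => ipSurf (p s) q) (-KSurf (r t) q) (Icc 0 T) t
  /- `δ κ K_Γ p + δ⁻¹ W_Γ'(p) + ε l = r` in `H¹(Γ)*` -/
  eq_d : ∀ t ∈ Icc 0 T, ∀ (q : H1Surf M.Ω) (g : HHalf M.Ω), (g : L2Surf M.Ω) = surfVal q →
    M.δ * M.κ * KSurf (p t) q + M.δ⁻¹ * nlSurf (deriv M.WΓ) (p t) q + M.ε * (l t).toLin g
      = ipSurf (r t) q
  /- `B u - p = 0` -/
  eq_e : ∀ t ∈ Icc 0 T, IsTrace (u t) (surfVal (p t))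

/-- Smoothness in time of a solution: `u`, `p` are Lipschitz with values in `L²(Ω)`, `L²(Γ)`, and the
chemical potentials `w`, `r = w_Γ` are Lipschitz with values in `H¹(Ω)`, `H¹(Γ)`. -/
def Model.LipschitzInTime (T : ℝ) (u w : ℝ → H1Bulk M.Ω) (p r : ℝ → H1Surf M.Ω) : Prop :=
  ∃ L : ℝ≥0, LipschitzOnWith L (fun t => bulkVal (u t)) (Icc 0 T) ∧
    LipschitzOnWith L (fun t => surfVal (p t)) (Icc 0 T) ∧
    LipschitzOnWith L w (Icc 0 T) ∧ LipschitzOnWith L r (Icc 0 T)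

end CahnHilliard

end

open CahnHilliard

noncomputable section

namespace CahnHilliard

/-! ### The surface measure is finite and constants lie in the Sobolev spaces -/

/-! Energy dissipation: test the mass balances with the new chemical potentials and the potential
equations with the increments. The increments are trace-compatible, so the multiplier cancels.
Expanding the convex part at the new iterate and the concave part at the old one
(`IsConvexConcaveSplitting.sub_le`) bounds the potential difference by the discrete nonlinear terms.
Finiteness is not free: the new potential is squeezed between integrable functions, using that the
derivative of the concave part at that iterate pairs with the constant 1. This requires constants in
both Sobolev spaces, hence a finite surface measure.

Accuracy: no inverse Laplacian is used. Each conservation law writes the error at step `n` as the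
divergence of an explicit flux `G n`: pairing it with `v` equals the inner product of `G n` with the
gradient of `v` (`exists_error_flux`). Testing the error equations with the errors cancels the
multipliers; the pairing with the potential error becomes a telescoping difference of squared fluxes
plus consistency terms. The flux norms bound the dual norms, and Cauchy–Schwarz for the flux
identity at `v` = error interpolates the `L²` error between flux and gradient. The Lipschitz terms
can therefore be absorbed, and `exists_gronwall_bound` closes the argument with no smallness
condition on the step size. -/

theorem hausdorffMeasure_graph_ne_top {n : ℕ} {e x : EuclideanSpace ℝ (Fin (n + 1))}
    (he : ‖e‖ = 1) (r : ℝ) {K : ℝ≥0} {γ : EuclideanSpace ℝ (Fin (n + 1)) → ℝ}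
    (hγ : LipschitzWith K γ) :
    Measure.hausdorffMeasure (n : ℝ)
      {y ∈ Metric.ball x r | inner ℝ y e = γ (y - inner ℝ y e • e)} ≠ ⊤ := by
  have : Fact (Module.finrank ℝ (EuclideanSpace ℝ (Fin (n + 1))) = n + 1) := ⟨by simp⟩
  have he0 : e ≠ 0 := by rintro rfl; simp at he
  let b := OrthonormalBasis.fromOrthogonalSpanSingleton (𝕜 := ℝ) n he0
  let ι : EuclideanSpace ℝ (Fin n) →ₗᵢ[ℝ] EuclideanSpace ℝ (Fin (n + 1)) :=
    (ℝ ∙ e)ᗮ.subtypeₗᵢ.comp b.repr.symm.toLinearIsometry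
  have hι : LipschitzWith 1 ι := ι.lipschitz
  -- With `ι` identifying `ℝⁿ` with the hyperplane orthogonal to `e`, this Lipschitz map
  -- parametrises the graph, so a ball of finite measure is enough to cover the piece.
  have hF : LipschitzWith (1 + K * 1) fun z => ι z + γ (ι z) • e := by
    refine hι.add ?_
    have h := hγ.comp hι
    refine LipschitzWith.of_dist_le_mul fun a c => ?_
    rw [dist_eq_norm, ← sub_smul, norm_smul, he, mul_one, ← dist_eq_norm]
    exact h.dist_le_mul a c
  have hsub : {y ∈ Metric.ball x r | inner ℝ y e = γ (y - inner ℝ y e • e)} ⊆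
      (fun z => ι z + γ (ι z) • e) '' Metric.closedBall 0 (2 * (‖x‖ + r)) := by
    rintro y ⟨hy, hg⟩
    have hmem : y - inner ℝ y e • e ∈ (ℝ ∙ e)ᗮ := by
      rw [Submodule.mem_orthogonal_singleton_iff_inner_left, inner_sub_left, inner_smul_left,
        real_inner_self_eq_norm_sq, he]
      simp
    have hz : ι (b.repr ⟨_, hmem⟩) = y - inner ℝ y e • e := by simp [ι]
    refine ⟨b.repr ⟨_, hmem⟩, ?_, ?_⟩
    · rw [mem_closedBall_zero_iff, ← ι.norm_map, hz]
      have h1 : ‖y‖ ≤ ‖x‖ + r := by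
        have h2 := norm_le_norm_add_norm_sub x y
        have h3 : ‖x - y‖ < r := by rw [norm_sub_rev]; exact mem_ball_iff_norm.1 hy
        linarith
      calc ‖y - inner ℝ y e • e‖ ≤ ‖y‖ + ‖inner ℝ y e • e‖ := norm_sub_le _ _
        _ ≤ ‖y‖ + ‖y‖ := by
          gcongr
          rw [norm_smul, he, mul_one]
          simpa [he] using norm_inner_le_norm (𝕜 := ℝ) y e
        _ ≤ _ := by linarith
    · simp only [hz, ← hg, sub_add_cancel]
  refine ne_top_of_le_ne_top ?_ (measure_mono hsub)
  refine ne_top_of_le_ne_top ?_ (hF.hausdorffMeasure_image_le (Nat.cast_nonneg n) _)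
  refine ENNReal.mul_ne_top (by simp) ?_
  exact (isCompact_closedBall _ _).measure_lt_top.ne

/-- A frontier point of an open set lies outside it, so not strictly below the graph; strictly
above, a whole neighbourhood would miss `Ω`. -/
theorem IsBoundedLipschitzDomain.frontier_inter_ball_subset {d : ℕ}
    {Ω : Set (EuclideanSpace ℝ (Fin d))} (hΩ : IsOpen Ω) {e x : EuclideanSpace ℝ (Fin d)} {r : ℝ}
    {γ : EuclideanSpace ℝ (Fin d) → ℝ} (hγ : Continuous γ)
    (h : ∀ y ∈ Metric.ball x r, y ∈ Ω ↔ inner ℝ y e < γ (y - inner ℝ y e • e)) :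
    frontier Ω ∩ Metric.ball x r ⊆
      {y ∈ Metric.ball x r | inner ℝ y e = γ (y - inner ℝ y e • e)} := by
  rintro y ⟨hy, hyb⟩
  refine ⟨hyb, ?_⟩
  rw [hΩ.frontier_eq] at hy
  refine le_antisymm ?_ (not_lt.1 fun hlt => hy.2 ((h y hyb).2 hlt))
  by_contra! hlt
  have hopen : IsOpen {z : EuclideanSpace ℝ (Fin d) |
      γ (z - inner ℝ z e • e) < inner ℝ z e} :=
    isOpen_lt (by fun_prop) (by fun_prop)
  obtain ⟨z, ⟨hz1, hz2⟩, hz3⟩ :=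
    mem_closure_iff.1 hy.1 _ (hopen.inter Metric.isOpen_ball) ⟨hlt, hyb⟩
  exact lt_asymm ((h z hz2).1 hz3) hz1

theorem isFiniteMeasure_surfaceMeasure {d : ℕ} (hd : d ≠ 0) {Ω : Set (EuclideanSpace ℝ (Fin d))}
    (hΩ : IsBoundedLipschitzDomain Ω) : IsFiniteMeasure (surfaceMeasure Ω) := by
  obtain ⟨n, rfl⟩ := Nat.exists_eq_succ_of_ne_zero hd
  have hc : IsCompact (frontier Ω) :=
    Metric.isCompact_of_isClosed_isBounded isClosed_frontier
      (hΩ.isBounded.closure.subset frontier_subset_closure)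
  refine ⟨?_⟩
  rw [surfaceMeasure, Measure.restrict_apply_univ]
  refine hc.measure_lt_top_of_nhdsWithin fun x hx => ?_
  obtain ⟨e, he, r, hr, K, γ, hγ, h⟩ := hΩ.locally_subgraph x hx
  refine ⟨frontier Ω ∩ Metric.ball x r,
    inter_mem_nhdsWithin _ (Metric.ball_mem_nhds x hr), ?_⟩
  refine (measure_mono (IsBoundedLipschitzDomain.frontier_inter_ball_subset hΩ.isOpen
    hγ.continuous h)).trans_lt ?_
  rw [Measure.euclideanHausdorffMeasure_def, Measure.smul_apply, ENNReal.smul_def]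
  exact ENNReal.mul_lt_top (by simp) (hausdorffMeasure_graph_ne_top he r hγ).lt_top

theorem isFiniteMeasure_restrict {d : ℕ} {Ω : Set (EuclideanSpace ℝ (Fin d))}
    (hΩ : Bornology.IsBounded Ω) : IsFiniteMeasure (volume.restrict Ω) :=
  ⟨by rw [Measure.restrict_apply_univ]; exact hΩ.measure_lt_top⟩

theorem integral_gradient_eq_zero {d : ℕ} {φ : EuclideanSpace ℝ (Fin d) → ℝ}
    (hφ : ContDiff ℝ ∞ φ) (hc : HasCompactSupport φ) : ∫ x, gradient φ x = 0 := by
  have hi : Integrable (gradient φ) :=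
    (continuous_gradient_test hφ).integrable_of_hasCompactSupport (hasCompactSupport_gradient hc)
  refine ext_inner_right ℝ fun v => ?_
  have hfi : Integrable (fun x => fderiv ℝ φ x v) := by
    simpa [gradient] using hi.inner_const (𝕜 := ℝ) v
  have h := integral_mul_fderiv_eq_neg_fderiv_mul_of_integrable (μ := volume)
    (f := fun _ : EuclideanSpace ℝ (Fin d) => (1 : ℝ)) (g := φ) (v := v) (by simp)
    (by simpa using hfi)
    (by simpa using hφ.continuous.integrable_of_hasCompactSupport hc)
    (fun x _ => by fun_prop) (fun x _ => (hφ.differentiable (by simp)) x)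
  have h2 := integral_inner (𝕜 := ℝ) hi v
  rw [real_inner_comm, ← h2, inner_zero_left]
  have h3 : ∀ x, inner ℝ v (gradient φ x) = fderiv ℝ φ x v := fun x => by
    rw [real_inner_comm]; simp [gradient]
  simp_rw [h3]
  simpa using h

/-- Constants serve as test functions: they turn `InDualBulk f u` into integrability of `f(u)`
itself. -/
theorem exists_bulkVal_eq_one {d : ℕ} {Ω : Set (EuclideanSpace ℝ (Fin d))}
    (hΩ : Bornology.IsBounded Ω) : ∃ v : H1Bulk Ω, bulkVal v =ᵐ[volume.restrict Ω] fun _ => 1 := by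
  have := isFiniteMeasure_restrict hΩ
  have h1 : MemLp (fun _ : EuclideanSpace ℝ (Fin d) => (1 : ℝ)) 2 (volume.restrict Ω) :=
    memLp_const 1
  refine ⟨⟨WithLp.toLp 2 (h1.toLp, 0), fun φ hφ hc hs => ?_⟩, h1.coeFn_toLp⟩
  have e1 : ∫ x in Ω, h1.toLp _ x • gradient φ x = ∫ x in Ω, gradient φ x := by
    refine integral_congr_ae ?_
    filter_upwards [h1.coeFn_toLp] with x hx
    rw [hx, one_smul]
  have e2 : ∫ x in Ω, φ x • (0 : Lp (EuclideanSpace ℝ (Fin d)) 2 (volume.restrict Ω)) x = 0 := by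
    refine (integral_congr_ae (g := fun _ => 0) ?_).trans (by simp)
    filter_upwards [Lp.coeFn_zero (EuclideanSpace ℝ (Fin d)) 2 (volume.restrict Ω)] with x hx
    rw [hx, Pi.zero_apply, smul_zero]
  have e3 : ∫ x in Ω, gradient φ x = 0 := by
    rw [setIntegral_eq_integral_of_forall_compl_eq_zero, integral_gradient_eq_zero hφ hc]
    intro x hx
    have : fderiv ℝ φ x = 0 := by
      by_contra h
      exact hx (hs (support_fderiv_subset ℝ h))
    simp [gradient, this]
  change ∫ x in Ω, h1.toLp _ x • gradient φ x = -∫ x in Ω, φ x •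
    (0 : Lp (EuclideanSpace ℝ (Fin d)) 2 (volume.restrict Ω)) x
  rw [e1, e2, e3, neg_zero]

theorem exists_surfVal_eq_one {d : ℕ} {Ω : Set (EuclideanSpace ℝ (Fin d))}
    (hΩ : Bornology.IsBounded Ω) [IsFiniteMeasure (surfaceMeasure Ω)] :
    ∃ q : H1Surf Ω, surfVal q =ᵐ[surfaceMeasure Ω] fun _ => 1 := by
  have h1 : MemLp (fun _ : EuclideanSpace ℝ (Fin d) => (1 : ℝ)) 2 (surfaceMeasure Ω) :=
    memLp_const 1
  obtain ⟨ρ, hρ0, hρ⟩ := hΩ.closure.subset_ball_lt 0 0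
  -- A bump equal to 1 near the closure of `Ω` represents the constant 1 with vanishing tangential
  -- gradient on the boundary.
  let b : ContDiffBump (0 : EuclideanSpace ℝ (Fin d)) := ⟨ρ, ρ + 1, hρ0, by linarith⟩
  have hb : ∀ x ∈ frontier Ω, ∀ᶠ y in nhds x, b y = 1 := fun x hx => by
    filter_upwards [Metric.isOpen_ball.mem_nhds (hρ (frontier_subset_closure hx))] with y hy
    exact b.one_of_mem_closedBall (Metric.ball_subset_closedBall hy)
  refine ⟨⟨WithLp.toLp 2 (h1.toLp, 0), Submodule.le_topologicalClosure _
    (Submodule.subset_span ⟨b, b.contDiff, b.hasCompactSupport, ?_, ?_⟩)⟩, h1.coeFn_toLp⟩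
  · filter_upwards [h1.coeFn_toLp, ae_restrict_mem isClosed_frontier.measurableSet] with x hx hxf
    change h1.toLp _ x = _
    rw [hx, (hb x hxf).self_of_nhds]
  · filter_upwards [Lp.coeFn_zero (EuclideanSpace ℝ (Fin d)) 2 (surfaceMeasure Ω),
      ae_restrict_mem isClosed_frontier.measurableSet] with x hx hxf
    change (0 : Lp (EuclideanSpace ℝ (Fin d)) 2 (surfaceMeasure Ω)) x = _
    have hf : fderiv ℝ b x = 0 := by
      rw [Filter.EventuallyEq.fderiv_eq (f := fun _ => (1 : ℝ)) (hb x hxf)]; simp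
    rw [hx, surfaceGradient, gradient, hf]
    simp

/-! ### Convex-concave splittings -/

theorem IsConvexConcaveSplitting.differentiableAt_plus {J : Set ℝ} {f fp fm : ℝ → ℝ}
    (h : IsConvexConcaveSplitting J f fp fm) {x : ℝ} (hx : x ∈ J) : DifferentiableAt ℝ fp x :=
  h.differentiable_plus.differentiableAt (h.isOpen.mem_nhds hx)

theorem IsConvexConcaveSplitting.differentiableAt_minus {J : Set ℝ} {f fp fm : ℝ → ℝ}
    (h : IsConvexConcaveSplitting J f fp fm) {x : ℝ} (hx : x ∈ J) : DifferentiableAt ℝ fm x :=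
  h.differentiable_minus.differentiableAt (h.isOpen.mem_nhds hx)

theorem IsConvexConcaveSplitting.deriv_eq {J : Set ℝ} {f fp fm : ℝ → ℝ}
    (h : IsConvexConcaveSplitting J f fp fm) {x : ℝ} (hx : x ∈ J) :
    deriv f x = deriv fp x - deriv fm x := by
  have he : f =ᶠ[nhds x] fun y => fp y - fm y := by
    filter_upwards [h.isOpen.mem_nhds hx] with y hy using h.eq_sub y hy
  rw [he.deriv_eq]
  exact deriv_fun_sub (h.differentiableAt_plus hx) (h.differentiableAt_minus hx)

theorem _root_.ConvexOn.deriv_mul_sub_le {S : Set ℝ} {f : ℝ → ℝ} (hf : ConvexOn ℝ S f) {x y : ℝ}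
    (hx : x ∈ S) (hy : y ∈ S) (hd : DifferentiableAt ℝ f x) :
    deriv f x * (y - x) ≤ f y - f x := by
  rcases lt_trichotomy x y with hxy | rfl | hxy
  · have h := hf.deriv_le_slope hx hy hxy hd
    rwa [slope_def_field, le_div_iff₀ (sub_pos.2 hxy)] at h
  · simp
  · have h := hf.slope_le_deriv hy hx hxy hd
    rw [slope_def_field, div_le_iff₀ (sub_pos.2 hxy)] at h
    linarith

/-- The reason for the splitting: the tangent of `fp` at the new value `y` and that of `fm` at the
old value `x` both err in the favourable direction. -/
theorem IsConvexConcaveSplitting.sub_le {J : Set ℝ} {f fp fm : ℝ → ℝ}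
    (h : IsConvexConcaveSplitting J f fp fm) {x y : ℝ} (hx : x ∈ J) (hy : y ∈ J) :
    f y - f x ≤ deriv fp y * (y - x) - deriv fm x * (y - x) := by
  have h1 := h.convex_plus.deriv_mul_sub_le hy hx (h.differentiableAt_plus hy)
  have h2 := h.convex_minus.deriv_mul_sub_le hx hy (h.differentiableAt_minus hx)
  rw [h.eq_sub x hx, h.eq_sub y hy]
  linarith

/-- Lower bound for the potential from the tangent of `fp` at a fixed `a` and of `fm` at `y`. It is
expanded so that `deriv fm y` appears only multiplied by `y` or by a constant, both admissible test
functions. -/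
theorem IsConvexConcaveSplitting.le_apply {J : Set ℝ} {f fp fm : ℝ → ℝ}
    (h : IsConvexConcaveSplitting J f fp fm) {a y : ℝ} (ha : a ∈ J) (hy : y ∈ J) :
    f a + deriv fp a * (y - a) - (deriv fm y * y - a * deriv fm y) ≤ f y := by
  have h1 := h.convex_plus.deriv_mul_sub_le ha hy (h.differentiableAt_plus ha)
  have h2 := h.convex_minus.deriv_mul_sub_le hy ha (h.differentiableAt_minus hy)
  rw [h.eq_sub a ha, h.eq_sub y hy]
  linarith

/-! ### Integral inequalities for potentials composed with `L²` functions. -/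

section Measure

variable {α : Type*} [MeasurableSpace α] {μ : Measure α} {J : Set ℝ} {f fp fm : ℝ → ℝ}

/-- Nothing is known about `f` off `J`, so it is replaced there by zero; the values of `u` avoid
that set almost everywhere. -/
theorem IsConvexConcaveSplitting.aestronglyMeasurable_comp
    (h : IsConvexConcaveSplitting J f fp fm) {u : α → ℝ} (hu : AEStronglyMeasurable u μ)
    (hJ : ∀ᵐ x ∂μ, u x ∈ J) : AEStronglyMeasurable (fun x => f (u x)) μ := by
  classical
  have hc : ContinuousOn f J :=
    (h.differentiable_plus.continuousOn.sub h.differentiable_minus.continuousOn).congr h.eq_sub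
  have hm : Measurable (J.piecewise f 0) :=
    hc.measurable_piecewise continuousOn_const h.isOpen.measurableSet
  refine (hm.comp_aemeasurable hu.aemeasurable).aestronglyMeasurable.congr ?_
  filter_upwards [hJ] with x hx
  simp [hx]

theorem IsConvexConcaveSplitting.integrable_comp [IsFiniteMeasure μ]
    (h : IsConvexConcaveSplitting J f fp fm) (u₀ u₁ : Lp ℝ 2 μ)
    (hJ₀ : ∀ᵐ x ∂μ, u₀ x ∈ J) (hJ₁ : ∀ᵐ x ∂μ, u₁ x ∈ J)
    (hf₀ : Integrable (fun x => f (u₀ x)) μ)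
    (hp : Integrable (fun x => deriv fp (u₁ x) * (u₁ - u₀) x) μ)
    (hm : Integrable (fun x => deriv fm (u₀ x) * (u₁ - u₀) x) μ)
    (hm₁ : Integrable (fun x => deriv fm (u₁ x) * u₁ x) μ)
    (hm₂ : Integrable (fun x => deriv fm (u₁ x)) μ) :
    Integrable (fun x => f (u₁ x)) μ := by
  rcases J.eq_empty_or_nonempty with rfl | ⟨a, ha⟩
  -- With `J` empty there is no base point `a`, but then the range condition forces the measure to
  -- vanish.
  · have : μ = 0 := by simpa using hJ₀
    subst this
    exact integrable_zero_measure
  have hu₁ : Integrable u₁ μ := (Lp.memLp u₁).integrable one_le_two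
  refine integrable_of_le_of_le
    (g₁ := fun x => f a + deriv fp a * (u₁ x - a)
      - (deriv fm (u₁ x) * u₁ x - a * deriv fm (u₁ x)))
    (g₂ := fun x => f (u₀ x) + (deriv fp (u₁ x) * (u₁ - u₀) x
      - deriv fm (u₀ x) * (u₁ - u₀) x))
    (h.aestronglyMeasurable_comp hu₁.aestronglyMeasurable hJ₁) ?_ ?_ ?_ ?_
  · filter_upwards [hJ₁] with x hx using h.le_apply ha hx
  · filter_upwards [hJ₀, hJ₁, Lp.coeFn_sub u₁ u₀] with x hx hy e
    have := h.sub_le hx hy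
    rw [e, Pi.sub_apply]
    linarith
  · exact ((integrable_const _).add ((hu₁.sub (integrable_const _)).const_mul _)).sub
      (hm₁.sub (hm₂.const_mul _))
  · exact hf₀.add (hp.sub hm)

theorem IsConvexConcaveSplitting.integral_sub_le
    (h : IsConvexConcaveSplitting J f fp fm) (u₀ u₁ : Lp ℝ 2 μ)
    (hJ₀ : ∀ᵐ x ∂μ, u₀ x ∈ J) (hJ₁ : ∀ᵐ x ∂μ, u₁ x ∈ J)
    (hf₀ : Integrable (fun x => f (u₀ x)) μ) (hf₁ : Integrable (fun x => f (u₁ x)) μ)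
    (hp : Integrable (fun x => deriv fp (u₁ x) * (u₁ - u₀) x) μ)
    (hm : Integrable (fun x => deriv fm (u₀ x) * (u₁ - u₀) x) μ) :
    ∫ x, f (u₁ x) ∂μ - ∫ x, f (u₀ x) ∂μ ≤
      ∫ x, deriv fp (u₁ x) * (u₁ - u₀) x ∂μ - ∫ x, deriv fm (u₀ x) * (u₁ - u₀) x ∂μ := by
  rw [← integral_sub hf₁ hf₀, ← integral_sub hp hm]
  refine integral_mono_ae (hf₁.sub hf₀) (hp.sub hm) ?_
  filter_upwards [hJ₀, hJ₁, Lp.coeFn_sub u₁ u₀] with x hx hy e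
  have h1 := h.sub_le hx hy
  rw [Pi.sub_apply] at e
  rw [← e] at h1
  exact h1

/-- The nonlinear part of the error equation, tested with the error: the convex part is monotone,
the explicit concave part is Lipschitz. -/
theorem IsConvexConcaveSplitting.neg_le_integral_error
    (h : IsConvexConcaveSplitting J f fp fm) {L : ℝ≥0} (hL : LipschitzOnWith L (deriv fm) J)
    (U u₀ u₁ : Lp ℝ 2 μ) (hJ : ∀ᵐ x ∂μ, U x ∈ J)
    (hJ₀ : ∀ᵐ x ∂μ, u₀ x ∈ J) (hJ₁ : ∀ᵐ x ∂μ, u₁ x ∈ J)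
    (hf : Integrable (fun x => deriv f (U x) * (U - u₁) x) μ)
    (hp : Integrable (fun x => deriv fp (u₁ x) * (U - u₁) x) μ)
    (hm : Integrable (fun x => deriv fm (u₀ x) * (U - u₁) x) μ) :
    -(L * ‖U - u₀‖ * ‖U - u₁‖) ≤ ∫ x, deriv f (U x) * (U - u₁) x ∂μ -
      (∫ x, deriv fp (u₁ x) * (U - u₁) x ∂μ - ∫ x, deriv fm (u₀ x) * (U - u₁) x ∂μ) := by
  have hn := fun v : Lp ℝ 2 μ => (Lp.memLp v).norm
  have hi : Integrable (fun x => ‖(U - u₀) x‖ * ‖(U - u₁) x‖) μ :=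
    (hn (U - u₀)).integrable_mul (hn (U - u₁))
  -- Cauchy–Schwarz for the pointwise norms, regarded as elements of `L²`.
  have hcs : ∫ x, ‖(U - u₀) x‖ * ‖(U - u₁) x‖ ∂μ ≤ ‖U - u₀‖ * ‖U - u₁‖ := by
    have h1 : inner ℝ ((hn (U - u₀)).toLp _) ((hn (U - u₁)).toLp _) =
        ∫ x, ‖(U - u₀) x‖ * ‖(U - u₁) x‖ ∂μ := by
      rw [L2.inner_def]
      refine integral_congr_ae ?_
      filter_upwards [(hn (U - u₀)).coeFn_toLp, (hn (U - u₁)).coeFn_toLp] with x h1 h2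
      rw [h1, h2]
      simp [mul_comm]
    have h2 : ∀ v : Lp ℝ 2 μ, ‖(hn v).toLp _‖ = ‖v‖ := fun v => by
      rw [Lp.norm_toLp, eLpNorm_norm, Lp.norm_def]
    rw [← h1, ← h2 (U - u₀), ← h2 (U - u₁)]
    exact real_inner_le_norm _ _
  have hcs' := mul_le_mul_of_nonneg_left hcs L.coe_nonneg
  have hpm : Integrable (fun x => deriv fp (u₁ x) * (U - u₁) x
      - deriv fm (u₀ x) * (U - u₁) x) μ := hp.sub hm
  rw [← integral_sub hp hm, ← integral_sub hf hpm]
  refine le_trans ?_ (integral_mono_ae (f := fun x => -(L * (‖(U - u₀) x‖ * ‖(U - u₁) x‖)))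
    (hi.const_mul _).neg (hf.sub hpm) ?_)
  · rw [integral_neg, integral_const_mul]
    linarith
  · filter_upwards [hJ, hJ₀, hJ₁, Lp.coeFn_sub U u₀, Lp.coeFn_sub U u₁] with x hx hx₀ hx₁ e₀ e₁
    rw [e₀, e₁]
    simp only [Pi.sub_apply, Real.norm_eq_abs]
    rw [h.deriv_eq hx]
    have hmono : 0 ≤ (deriv fp (U x) - deriv fp (u₁ x)) * (U x - u₁ x) := by
      have hmon := h.convex_plus.monotoneOn_deriv fun y hy => h.differentiableAt_plus hy
      rcases le_total (U x) (u₁ x) with hle | hle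
      · exact mul_nonneg_of_nonpos_of_nonpos (sub_nonpos.2 (hmon hx hx₁ hle)) (sub_nonpos.2 hle)
      · exact mul_nonneg (sub_nonneg.2 (hmon hx₁ hx hle)) (sub_nonneg.2 hle)
    have hlip : |deriv fm (U x) - deriv fm (u₀ x)| ≤ L * |U x - u₀ x| := by
      simpa [Real.dist_eq] using hL.dist_le_mul _ hx _ hx₀
    have h3 : (deriv fm (U x) - deriv fm (u₀ x)) * (U x - u₁ x) ≤
        L * |U x - u₀ x| * |U x - u₁ x| :=
      (le_abs_self _).trans (by rw [abs_mul]; gcongr)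
    nlinarith

end Measure

/-! ### The bilinear forms as inner products -/

/-- The term `‖x - y‖² / 2` is discarded. This is the source of both the gradient energy decay and
the telescoping of the flux norms. -/
theorem half_sub_le_inner {H : Type*} [NormedAddCommGroup H] [InnerProductSpace ℝ H] (x y : H) :
    (‖x‖ ^ 2 - ‖y‖ ^ 2) / 2 ≤ inner ℝ x (x - y) := by
  have h := norm_sub_sq_real x y
  rw [inner_sub_right, real_inner_self_eq_norm_sq]
  nlinarith [sq_nonneg ‖x - y‖]

section Forms

variable {d : ℕ} {Ω : Set (EuclideanSpace ℝ (Fin d))}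

theorem ipBulk_eq_inner (u v : H1Bulk Ω) : ipBulk u v = inner ℝ (bulkVal u) (bulkVal v) := by
  rw [L2.inner_def]
  simp [ipBulk, mul_comm]

theorem ipSurf_eq_inner (p q : H1Surf Ω) : ipSurf p q = inner ℝ (surfVal p) (surfVal q) := by
  rw [L2.inner_def]
  simp [ipSurf, mul_comm]

theorem KBulk_eq_inner (u v : H1Bulk Ω) : KBulk u v = inner ℝ (bulkGrad u) (bulkGrad v) := rfl

theorem KSurf_eq_inner (p q : H1Surf Ω) : KSurf p q = inner ℝ (surfGrad p) (surfGrad q) := rfl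

theorem bulkVal_sub (u v : H1Bulk Ω) : bulkVal (u - v) = bulkVal u - bulkVal v := rfl

theorem bulkGrad_sub (u v : H1Bulk Ω) : bulkGrad (u - v) = bulkGrad u - bulkGrad v := rfl

theorem surfVal_sub (p q : H1Surf Ω) : surfVal (p - q) = surfVal p - surfVal q := rfl

theorem surfGrad_sub (p q : H1Surf Ω) : surfGrad (p - q) = surfGrad p - surfGrad q := rfl

theorem norm_sq_bulk (u : H1Bulk Ω) : ‖u‖ ^ 2 = ‖bulkVal u‖ ^ 2 + ‖bulkGrad u‖ ^ 2 :=
  WithLp.prod_norm_sq_eq_of_L2 u.1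

theorem norm_sq_surf (p : H1Surf Ω) : ‖p‖ ^ 2 = ‖surfVal p‖ ^ 2 + ‖surfGrad p‖ ^ 2 :=
  WithLp.prod_norm_sq_eq_of_L2 p.1

theorem ipBulk_comm (u v : H1Bulk Ω) : ipBulk u v = ipBulk v u := by
  rw [ipBulk_eq_inner, ipBulk_eq_inner, real_inner_comm]

theorem ipBulk_sub_right (w u v : H1Bulk Ω) : ipBulk w (u - v) = ipBulk w u - ipBulk w v := by
  rw [ipBulk_eq_inner, ipBulk_eq_inner, ipBulk_eq_inner, bulkVal_sub, inner_sub_right]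

theorem ipBulk_sub_left (u v w : H1Bulk Ω) : ipBulk (u - v) w = ipBulk u w - ipBulk v w := by
  rw [ipBulk_eq_inner, ipBulk_eq_inner, ipBulk_eq_inner, bulkVal_sub, inner_sub_left]

theorem KBulk_self (u : H1Bulk Ω) : KBulk u u = ‖bulkGrad u‖ ^ 2 := by
  rw [KBulk_eq_inner, real_inner_self_eq_norm_sq]

theorem KBulk_sub_left (u v w : H1Bulk Ω) : KBulk (u - v) w = KBulk u w - KBulk v w := by
  rw [KBulk_eq_inner, KBulk_eq_inner, KBulk_eq_inner, bulkGrad_sub, inner_sub_left]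

theorem half_sub_le_KBulk (u v : H1Bulk Ω) :
    (‖bulkGrad u‖ ^ 2 - ‖bulkGrad v‖ ^ 2) / 2 ≤ KBulk u (u - v) := by
  rw [KBulk_eq_inner, bulkGrad_sub]
  exact half_sub_le_inner _ _

theorem ipSurf_comm (u v : H1Surf Ω) : ipSurf u v = ipSurf v u := by
  rw [ipSurf_eq_inner, ipSurf_eq_inner, real_inner_comm]

theorem ipSurf_sub_right (w u v : H1Surf Ω) : ipSurf w (u - v) = ipSurf w u - ipSurf w v := by
  rw [ipSurf_eq_inner, ipSurf_eq_inner, ipSurf_eq_inner, surfVal_sub, inner_sub_right]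

theorem ipSurf_sub_left (u v w : H1Surf Ω) : ipSurf (u - v) w = ipSurf u w - ipSurf v w := by
  rw [ipSurf_eq_inner, ipSurf_eq_inner, ipSurf_eq_inner, surfVal_sub, inner_sub_left]

theorem KSurf_self (u : H1Surf Ω) : KSurf u u = ‖surfGrad u‖ ^ 2 := by
  rw [KSurf_eq_inner, real_inner_self_eq_norm_sq]

theorem KSurf_sub_left (u v w : H1Surf Ω) : KSurf (u - v) w = KSurf u w - KSurf v w := by
  rw [KSurf_eq_inner, KSurf_eq_inner, KSurf_eq_inner, surfGrad_sub, inner_sub_left]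

theorem half_sub_le_KSurf (u v : H1Surf Ω) :
    (‖surfGrad u‖ ^ 2 - ‖surfGrad v‖ ^ 2) / 2 ≤ KSurf u (u - v) := by
  rw [KSurf_eq_inner, surfGrad_sub]
  exact half_sub_le_inner _ _

theorem norm_bulkGrad_le (u : H1Bulk Ω) : ‖bulkGrad u‖ ≤ ‖u‖ :=
  le_of_sq_le_sq (by rw [norm_sq_bulk]; nlinarith [sq_nonneg ‖bulkVal u‖]) (norm_nonneg u)

theorem norm_surfGrad_le (p : H1Surf Ω) : ‖surfGrad p‖ ≤ ‖p‖ :=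
  le_of_sq_le_sq (by rw [norm_sq_surf]; nlinarith [sq_nonneg ‖surfVal p‖]) (norm_nonneg p)

theorem IsTrace.sub {u v : H1Bulk Ω} {g h : L2Surf Ω} (hu : IsTrace u g) (hv : IsTrace v h) :
    IsTrace (u - v) (g - h) :=
  (traceGraph Ω).sub_mem hu hv

theorem IsTrace.mem_HHalf {u : H1Bulk Ω} {g : L2Surf Ω} (hu : IsTrace u g) : g ∈ HHalf Ω :=
  ⟨(u, g), hu, rfl⟩

end Forms

/-! ### Energy dissipation -/

section Energy

variable {d : ℕ} {M : Model d}

theorem Model.energyBulk_eq {u : H1Bulk M.Ω}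
    (h : Integrable (fun x => M.W (bulkVal u x)) (volume.restrict M.Ω)) :
    M.energyBulk u = M.ε / 2 * ‖bulkGrad u‖ ^ 2 + 1 / M.ε * ∫ x in M.Ω, M.W (bulkVal u x) := by
  rw [Model.energyBulk, integral_add ((L2.integrable_inner _ _).const_mul _) (h.const_mul _),
    integral_const_mul, integral_const_mul, ← real_inner_self_eq_norm_sq, L2.inner_def]

theorem Model.energySurf_eq {p : H1Surf M.Ω}
    (h : Integrable (fun x => M.WΓ (surfVal p x)) (surfaceMeasure M.Ω)) :
    M.energySurf p = M.δ * M.κ / 2 * ‖surfGrad p‖ ^ 2 +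
      1 / M.δ * ∫ x, M.WΓ (surfVal p x) ∂surfaceMeasure M.Ω := by
  rw [Model.energySurf, integral_add ((L2.integrable_inner _ _).const_mul _) (h.const_mul _),
    integral_const_mul, integral_const_mul, ← real_inner_self_eq_norm_sq, L2.inner_def]

variable {τ : ℝ} {u₀ u₁ w₁ : H1Bulk M.Ω} {p₀ p₁ r₁ : H1Surf M.Ω} {l₁ : HMinusHalf M.Ω}

/-- The step itself controls the concave derivative only at `u₀`; `hm` and `hmΓ` supply it at the
new iterate, where the lower bound needs it. -/
theorem Model.LiuWuStep.finiteEnergy (hd : d ≠ 0) (hM : M.Admissible)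
    (hs : M.LiuWuStep τ u₀ p₀ u₁ w₁ p₁ r₁ l₁) (h₀ : M.InRange u₀ p₀) (h₁ : M.InRange u₁ p₁)
    (hE : M.FiniteEnergy u₀ p₀) (hm : InDualBulk (deriv M.Wm) u₁)
    (hmΓ : InDualSurf (deriv M.WΓm) p₁) : M.FiniteEnergy u₁ p₁ := by
  have := isFiniteMeasure_restrict hM.domain.isBounded
  have := isFiniteMeasure_surfaceMeasure hd hM.domain
  obtain ⟨v, hv⟩ := exists_bulkVal_eq_one hM.domain.isBounded
  obtain ⟨q, hq⟩ := exists_surfVal_eq_one hM.domain.isBounded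
  refine ⟨hM.splitting.integrable_comp (bulkVal u₀) (bulkVal u₁) h₀.1 h₁.1 hE.1
      (hs.dual_plus (u₁ - u₀)) (hs.dual_minus (u₁ - u₀)) (hm u₁) ((hm v).congr ?_),
    hM.splittingΓ.integrable_comp (surfVal p₀) (surfVal p₁) h₀.2 h₁.2 hE.2
      (hs.dualΓ_plus (p₁ - p₀)) (hs.dualΓ_minus (p₁ - p₀)) (hmΓ p₁) ((hmΓ q).congr ?_)⟩
  · filter_upwards [hv] with x hx
    rw [hx, mul_one]
  · filter_upwards [hq] with x hx
    rw [hx, mul_one]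

theorem Model.LiuWuStep.energy_le (hM : M.Admissible) (hτ : 0 < τ)
    (hs : M.LiuWuStep τ u₀ p₀ u₁ w₁ p₁ r₁ l₁) (h₀ : M.InRange u₀ p₀) (h₁ : M.InRange u₁ p₁)
    (hE₀ : M.FiniteEnergy u₀ p₀) (hE₁ : M.FiniteEnergy u₁ p₁) (ht : IsTrace u₀ (surfVal p₀)) :
    M.energy u₁ p₁ ≤ M.energy u₀ p₀ := by
  have htr : IsTrace (u₁ - u₀) (surfVal (p₁ - p₀)) := hs.eq_e.sub ht
  -- Both potential equations are tested with the increment and the same element of `HHalf`, so the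
  -- two multiplier terms cancel in the sum.
  have hb := hs.eq_b _ ⟨_, htr.mem_HHalf⟩ htr
  have hd := hs.eq_d (p₁ - p₀) ⟨_, htr.mem_HHalf⟩ rfl
  have ha := hs.eq_a w₁
  have hc := hs.eq_c r₁
  have hW : _ ≤ nlBulk (deriv M.Wp) u₁ (u₁ - u₀) - nlBulk (deriv M.Wm) u₀ (u₁ - u₀) :=
    hM.splitting.integral_sub_le (bulkVal u₀) (bulkVal u₁) h₀.1 h₁.1 hE₀.1 hE₁.1
      (hs.dual_plus (u₁ - u₀)) (hs.dual_minus (u₁ - u₀))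
  have hWΓ : _ ≤ nlSurf (deriv M.WΓp) p₁ (p₁ - p₀) - nlSurf (deriv M.WΓm) p₀ (p₁ - p₀) :=
    hM.splittingΓ.integral_sub_le (surfVal p₀) (surfVal p₁) h₀.2 h₁.2 hE₀.2 hE₁.2
      (hs.dualΓ_plus (p₁ - p₀)) (hs.dualΓ_minus (p₁ - p₀))
  rw [ipBulk_sub_right] at hb
  rw [ipSurf_sub_right] at hd
  rw [ipBulk_comm, ipBulk_comm u₀, KBulk_self] at ha
  rw [ipSurf_comm, ipSurf_comm p₀, KSurf_self] at hc
  rw [Model.energy, Model.energy, M.energyBulk_eq hE₀.1, M.energyBulk_eq hE₁.1,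
    M.energySurf_eq hE₀.2, M.energySurf_eq hE₁.2, one_div, one_div]
  have g1 := mul_le_mul_of_nonneg_left (half_sub_le_KBulk u₁ u₀) hM.ε_pos.le
  have g2 := mul_le_mul_of_nonneg_left (half_sub_le_KSurf p₁ p₀)
    (mul_pos hM.δ_pos hM.κ_pos).le
  have g3 := mul_le_mul_of_nonneg_left hW (inv_nonneg.2 hM.ε_pos.le)
  have g4 := mul_le_mul_of_nonneg_left hWΓ (inv_nonneg.2 hM.δ_pos.le)
  have g5 : 0 ≤ τ * M.σ * ‖bulkGrad w₁‖ ^ 2 := by have := hM.σ_pos; positivity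
  have g6 : 0 ≤ τ * ‖surfGrad r₁‖ ^ 2 := by positivity
  linarith

end Energy

/-! ### A discrete Gronwall estimate -/

/-- Young's inequality for the interpolation bound; `η` sets how much of the gradient term `b` is
spent. -/
theorem le_add_of_sq_le_mul {a b c s η : ℝ} (ha : 0 ≤ a) (hb : 0 ≤ b) (hc : 0 ≤ c) (hη : 0 < η)
    (h : (s ^ 2) ^ 2 ≤ c * a * b) : s ^ 2 ≤ η * b + c / (4 * η) * a := by
  refine le_of_sq_le_sq (h.trans ?_) (by positivity)
  have h1 : c * a * b = 4 * (η * b) * (c / (4 * η) * a) := by field_simp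
  rw [h1]
  nlinarith [sq_nonneg (η * b - c / (4 * η) * a)]

/-- Absorption of the right-hand side of the error inequality. The coefficient of the implicit term
can be made as small as the length of the time interval requires. -/
theorem exists_absorbed_error_inequality {c C T : ℝ} (hc : 0 ≤ c) (hC : 0 < C) (hT : 0 < T) :
    ∃ D k θ : ℝ, 0 ≤ D ∧ 0 ≤ k ∧ 0 ≤ θ ∧ θ * T ≤ 1 / 2 ∧
      ∀ τ a b s a' b' s' : ℝ, 0 < τ → 0 ≤ a → 0 ≤ b → 0 ≤ a' → 0 ≤ b' →
        (s ^ 2) ^ 2 ≤ c * a * b → (s' ^ 2) ^ 2 ≤ c * a' * b' →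
        a' + τ * b' ≤ a + C * τ * ((τ + s) * s' + τ * √a') →
        (1 - θ * τ) * a' + 3 / 4 * (τ * b') ≤ (1 + k * τ) * a + τ * b / 4 + D * τ ^ 3 := by
  -- `μ` and `ν` are the Young weights; each contributes at most `1/4` to `θ * T`.
  set μ : ℝ := 1 / (2 * C * (c * T + 1)) with hμ
  have hμ0 : 0 < μ := by positivity
  set ν : ℝ := 1 / (4 * C * T) with hν
  have hν0 : 0 < ν := by positivity
  refine ⟨C * (1 / (2 * μ) + 1 / (4 * ν)), c * C ^ 2 / (4 * μ ^ 2), c * C ^ 2 * μ ^ 2 + C * ν,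
    by positivity, by positivity, by positivity, ?_, ?_⟩
  · have h1 : C * ν * T = 1 / 4 := by rw [hν]; field_simp
    have h2 : c * C ^ 2 * μ ^ 2 * T = c * T / (4 * (c * T + 1) ^ 2) := by
      rw [hμ]; field_simp; ring
    have h3 : c * T / (4 * (c * T + 1) ^ 2) ≤ 1 / 4 := by
      rw [div_le_div_iff₀ (by positivity) (by norm_num)]
      nlinarith [mul_nonneg hc hT.le, sq_nonneg (c * T)]
    linarith
  · intro τ a b s a' b' s' hτ ha hb ha' hb' hs hs' h
    have e1 : τ * s' ≤ 1 / (2 * μ) * τ ^ 2 + μ / 2 * s' ^ 2 := by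
      have h1 : 1 / (2 * μ) * τ ^ 2 + μ / 2 * s' ^ 2 - τ * s' = (τ - μ * s') ^ 2 / (2 * μ) := by
        field_simp; ring
      have : 0 ≤ (τ - μ * s') ^ 2 / (2 * μ) := by positivity
      linarith
    have e2 : s * s' ≤ 1 / (2 * μ) * s ^ 2 + μ / 2 * s' ^ 2 := by
      have h1 : 1 / (2 * μ) * s ^ 2 + μ / 2 * s' ^ 2 - s * s' = (s - μ * s') ^ 2 / (2 * μ) := by
        field_simp; ring
      have : 0 ≤ (s - μ * s') ^ 2 / (2 * μ) := by positivity
      linarith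
    have e3 : τ * √a' ≤ 1 / (4 * ν) * τ ^ 2 + ν * a' := by
      have h1 : 1 / (4 * ν) * τ ^ 2 + ν * √a' ^ 2 - τ * √a' = (τ - 2 * ν * √a') ^ 2 / (4 * ν) := by
        field_simp; ring
      rw [Real.sq_sqrt ha'] at h1
      have : 0 ≤ (τ - 2 * ν * √a') ^ 2 / (4 * ν) := by positivity
      linarith
    -- The two values of `η` are chosen so that the old and the new `L²` errors each cost exactly a
    -- quarter of the corresponding gradient term.
    have e4 : C * (1 / (2 * μ)) * s ^ 2 ≤ b / 4 + c * C ^ 2 / (4 * μ ^ 2) * a := by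
      have h1 := le_add_of_sq_le_mul (η := μ / (2 * C)) ha hb hc (by positivity) hs
      calc C * (1 / (2 * μ)) * s ^ 2
          ≤ C * (1 / (2 * μ)) * (μ / (2 * C) * b + c / (4 * (μ / (2 * C))) * a) := by gcongr
        _ = _ := by field_simp; ring
    have e5 : C * μ * s' ^ 2 ≤ b' / 4 + c * C ^ 2 * μ ^ 2 * a' := by
      have h1 := le_add_of_sq_le_mul (η := 1 / (4 * C * μ)) ha' hb' hc (by positivity) hs'
      calc C * μ * s' ^ 2
          ≤ C * μ * (1 / (4 * C * μ) * b' + c / (4 * (1 / (4 * C * μ))) * a') := by gcongr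
        _ = _ := by field_simp
    have e6 : C * ((τ + s) * s' + τ * √a') ≤ C * (1 / (2 * μ) + 1 / (4 * ν)) * τ ^ 2 +
        (b / 4 + c * C ^ 2 / (4 * μ ^ 2) * a) + (b' / 4 + c * C ^ 2 * μ ^ 2 * a') +
        C * ν * a' := by
      have h1 := mul_le_mul_of_nonneg_left (add_le_add (add_le_add e1 e2) e3) hC.le
      linarith
    have e7 := mul_le_mul_of_nonneg_left e6 hτ.le
    linarith

/-- Here `a` stands for the squared flux, `b` for the squared gradient and `s` for the `L²` error.
-/
theorem exists_gronwall_bound {c C T : ℝ} (hc : 0 ≤ c) (hC : 0 < C) (hT : 0 < T) :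
    ∃ K : ℝ, 0 ≤ K ∧ ∀ τ : ℝ, 0 < τ → ∀ N : ℕ, N * τ ≤ T → ∀ a b s : ℕ → ℝ,
      (∀ n, 0 ≤ a n) → (∀ n, 0 ≤ b n) → a 0 = 0 → b 0 = 0 →
      (∀ n ≤ N, (s n ^ 2) ^ 2 ≤ c * a n * b n) →
      (∀ n < N, a (n + 1) + τ * b (n + 1) ≤
        a n + C * τ * ((τ + s n) * s (n + 1) + τ * √(a (n + 1)))) →
      ∀ n ≤ N, a n ≤ K * τ ^ 2 ∧ τ * ∑ i ∈ Finset.Icc 1 n, b i ≤ K * τ ^ 2 := by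
  obtain ⟨D, k, θ, hD, hk, hθ, hθT, habs⟩ := exists_absorbed_error_inequality hc hC hT
  -- For `θτ ≤ 1/2` this gives `1 + kτ ≤ (1 + mτ)(1 - θτ)`, so the implicit factor can be kept
  -- inside `y`.
  set m := 2 * (k + θ) with hm
  have hm0 : 0 ≤ m := by positivity
  refine ⟨4 * (T * D * Real.exp (m * T)), by positivity, ?_⟩
  intro τ hτ N hN a b s ha hb ha0 hb0 hs hstep
  -- Of the available `3/4` of `τ * b (n + 1)`, one quarter pays for the explicit term of the next
  -- step and one quarter enters the running sum.
  set y : ℕ → ℝ := fun n =>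
    (1 - θ * τ) * a n + τ * b n / 4 + τ / 4 * ∑ i ∈ Finset.Icc 1 n, b i with hy
  have hsum : ∀ n, 0 ≤ ∑ i ∈ Finset.Icc 1 n, b i := fun n => Finset.sum_nonneg fun i _ => hb i
  have hθτ : ∀ n < N, θ * τ ≤ 1 / 2 := fun n hn => by
    have h1 : (1 : ℝ) ≤ N := by exact_mod_cast Nat.one_le_of_lt hn
    have h2 : τ ≤ T := by nlinarith
    exact (mul_le_mul_of_nonneg_left h2 hθ).trans hθT
  have hmain : ∀ n ≤ N, y n ≤ n * (D * τ ^ 3) * (1 + m * τ) ^ n := by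
    intro n
    induction n with
    | zero => intro _; simp [hy, ha0, hb0]
    | succ n ih =>
      intro hn
      have hn' : n < N := hn
      have hθn := hθτ n hn'
      have h1 := habs τ _ _ _ _ _ _ hτ (ha n) (hb n) (ha (n + 1)) (hb (n + 1)) (hs n hn'.le)
        (hs (n + 1) hn) (hstep n hn')
      have h2 : y (n + 1) ≤ (1 + m * τ) * y n + D * τ ^ 3 := by
        have e1 : (1 + k * τ) * a n ≤ (1 + m * τ) * ((1 - θ * τ) * a n) := by
          have : (1 + k * τ) ≤ (1 + m * τ) * (1 - θ * τ) := by
            have : 0 ≤ m * τ * (1 / 2 - θ * τ) :=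
              mul_nonneg (mul_nonneg hm0 hτ.le) (by linarith)
            rw [hm] at this ⊢
            nlinarith
          have := mul_le_mul_of_nonneg_right this (ha n)
          linarith
        have e2 : 0 ≤ m * τ * (τ * b n / 4 + τ / 4 * ∑ i ∈ Finset.Icc 1 n, b i) := by
          have := hb n
          have := hsum n
          positivity
        simp only [hy]
        rw [Finset.sum_Icc_succ_top (by omega)]
        have e3 := mul_nonneg hτ.le (hb (n + 1))
        linarith
      have hp : 1 ≤ (1 + m * τ) ^ (n + 1) := one_le_pow₀ (by nlinarith)
      have hD3 : 0 ≤ D * τ ^ 3 := by positivity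
      calc y (n + 1) ≤ (1 + m * τ) * y n + D * τ ^ 3 := h2
        _ ≤ (1 + m * τ) * (n * (D * τ ^ 3) * (1 + m * τ) ^ n) +
            D * τ ^ 3 * (1 + m * τ) ^ (n + 1) := by
          have e4 := le_mul_of_one_le_right hD3 hp
          have e5 := ih hn'.le
          gcongr
        _ = _ := by push_cast; ring
  intro n hn
  have hnT : n * τ ≤ T := le_trans (by gcongr) hN
  have hyn : y n ≤ T * D * Real.exp (m * T) * τ ^ 2 := by
    refine (hmain n hn).trans ?_
    have h1 : (1 + m * τ) ^ n ≤ Real.exp (m * T) := by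
      calc (1 + m * τ) ^ n ≤ Real.exp (m * τ) ^ n := by
            gcongr
            linarith [Real.add_one_le_exp (m * τ)]
        _ = Real.exp (m * (n * τ)) := by rw [← Real.exp_nat_mul]; ring_nf
        _ ≤ _ := by gcongr
    calc n * (D * τ ^ 3) * (1 + m * τ) ^ n = n * τ * (D * τ ^ 2) * (1 + m * τ) ^ n := by ring
      _ ≤ T * (D * τ ^ 2) * Real.exp (m * T) := by gcongr
      _ = _ := by ring
  have hE : 0 ≤ T * D * Real.exp (m * T) * τ ^ 2 := by positivity
  -- For `n = 0` possibly `N = 0`, and then `τ` need not be bounded by `T`; the claim is trivial in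
  -- that case.
  rcases Nat.eq_zero_or_pos n with rfl | hn0
  · simp only [ha0, Finset.Icc_eq_empty_of_lt zero_lt_one, Finset.sum_empty, mul_zero]
    constructor <;> linarith
  · have h1 := hθτ 0 (hn0.trans_le hn)
    have h2 : a n / 2 ≤ (1 - θ * τ) * a n := by nlinarith [ha n]
    have h3 := mul_nonneg hτ.le (hb n)
    have h4 := mul_nonneg hτ.le (hsum n)
    have h5 : y n = (1 - θ * τ) * a n + τ * b n / 4 + τ / 4 * ∑ i ∈ Finset.Icc 1 n, b i := rfl
    have := ha n
    constructor <;> linarith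

/-! ### Conservation laws in flux form -/

section Flux

variable {V X H : Type*} [NormedAddCommGroup X] [InnerProductSpace ℝ X] [NormedAddCommGroup H]
  [InnerProductSpace ℝ H]

/-- The consistency error of the implicit Euler method for a conservation law is the divergence of a
flux of second order in the step size. -/
theorem exists_consistency_flux [CompleteSpace H] {val : V → X} {grad : V → H} {c T : ℝ}
    (hc : 0 ≤ c) {L : ℝ≥0} {U Y : ℝ → V} (hY : LipschitzOnWith L (fun t => grad (Y t)) (Icc 0 T))
    (hU : ∀ t ∈ Icc 0 T, ∀ v, HasDerivWithinAt (fun s => inner ℝ (val (U s)) (val v))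
      (-(c * inner ℝ (grad (Y t)) (grad v))) (Icc 0 T) t)
    {s t : ℝ} (hs : 0 ≤ s) (hst : s ≤ t) (ht : t ≤ T) :
    ∃ ρ : H, ‖ρ‖ ≤ c * L * (t - s) ^ 2 ∧ ∀ v, inner ℝ (val (U t)) (val v) -
      inner ℝ (val (U s)) (val v) =
        -((t - s) * c * inner ℝ (grad (Y t)) (grad v)) + inner ℝ ρ (grad v) := by
  have hsub : Icc s t ⊆ Icc 0 T := Icc_subset_Icc hs ht
  have hcont : ContinuousOn (fun r => grad (Y r)) (uIcc s t) := by
    rw [uIcc_of_le hst]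
    exact hY.continuousOn.mono hsub
  have hi : IntervalIntegrable (fun r => grad (Y r)) volume s t := hcont.intervalIntegrable
  -- The time derivative exists only after testing, but the gradient of `Y` is continuous in time,
  -- so its deviation from the endpoint value can be integrated in `H`.
  refine ⟨-c • ∫ r in s..t, (grad (Y r) - grad (Y t)), ?_, fun v => ?_⟩
  · have h1 : ‖∫ r in s..t, (grad (Y r) - grad (Y t))‖ ≤ L * (t - s) * |t - s| := by
      refine intervalIntegral.norm_integral_le_of_norm_le_const fun r hr => ?_
      rw [uIoc_of_le hst] at hr
      have h2 := hY.dist_le_mul r (hsub (Ioc_subset_Icc_self hr)) t (hsub (right_mem_Icc.2 hst))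
      rw [dist_eq_norm, Real.dist_eq, abs_sub_comm, abs_of_nonneg (sub_nonneg.2 hr.2)] at h2
      refine h2.trans ?_
      gcongr
      exact hr.1.le
    rw [abs_of_nonneg (sub_nonneg.2 hst)] at h1
    rw [norm_smul, norm_neg, Real.norm_of_nonneg hc]
    calc c * _ ≤ c * (L * (t - s) * (t - s)) := by gcongr
      _ = _ := by ring
  · have h1 := intervalIntegral.integral_eq_sub_of_hasDerivAt_of_le hst
      (f := fun r => inner ℝ (val (U r)) (val v))
      (f' := fun r => -(c * inner ℝ (grad (Y r)) (grad v)))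
      (fun r hr => ((hU r (hsub hr) v).mono hsub).continuousWithinAt)
      (fun r hr => ((hU r (hsub (Ioo_subset_Icc_self hr)) v).mono hsub).hasDerivAt
        (Icc_mem_nhds hr.1 hr.2))
      ((continuousOn_const.mul (hcont.inner continuousOn_const)).neg.intervalIntegrable)
    have h2 : ∫ r in s..t, inner ℝ (grad (Y r)) (grad v) =
        inner ℝ (∫ r in s..t, grad (Y r)) (grad v) := by
      have := ((innerSL ℝ (grad v)).intervalIntegral_comp_comm hi)
      simp only [innerSL_apply_apply] at this
      rw [real_inner_comm, ← this]
      simp only [real_inner_comm]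
    rw [← h1, intervalIntegral.integral_neg, intervalIntegral.integral_const_mul, h2,
      intervalIntegral.integral_sub hi (by simp), intervalIntegral.integral_const,
      inner_smul_left, inner_sub_left, inner_smul_left]
    simp
    ring

/-- The error of the implicit Euler method for a conservation law, as the divergence of a flux. -/
theorem exists_error_flux [CompleteSpace H] {val : V → X} {grad : V → H} {c T : ℝ}
    (hc : 0 ≤ c) {L : ℝ≥0} {U Y : ℝ → V} (hY : LipschitzOnWith L (fun t => grad (Y t)) (Icc 0 T))
    (hU : ∀ t ∈ Icc 0 T, ∀ v, HasDerivWithinAt (fun s => inner ℝ (val (U s)) (val v))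
      (-(c * inner ℝ (grad (Y t)) (grad v))) (Icc 0 T) t)
    {τ : ℝ} (hτ : 0 < τ) {N : ℕ} (hN : N * τ ≤ T) {u w : ℕ → V} (h0 : u 0 = U 0)
    (hu : ∀ n < N, ∀ v, inner ℝ (val (u (n + 1))) (val v) +
      τ * c * inner ℝ (grad (w (n + 1))) (grad v) = inner ℝ (val (u n)) (val v)) :
    ∃ G : ℕ → H, G 0 = 0 ∧
      (∀ n ≤ N, ∀ v, inner ℝ (val (U (n * τ)) - val (u n)) (val v) = inner ℝ (G n) (grad v)) ∧
      ∀ n < N, τ * c * inner ℝ (G (n + 1)) (grad (Y ((n + 1 : ℕ) * τ)) - grad (w (n + 1))) ≤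
        (‖G n‖ ^ 2 - ‖G (n + 1)‖ ^ 2) / 2 + c * L * τ ^ 2 * ‖G (n + 1)‖ := by
  have hex : ∀ n : ℕ, ∃ ρ : H, n < N → ‖ρ‖ ≤ c * L * τ ^ 2 ∧
      ∀ v, inner ℝ (val (U ((n + 1 : ℕ) * τ))) (val v) - inner ℝ (val (U (n * τ))) (val v) =
        -(τ * c * inner ℝ (grad (Y ((n + 1 : ℕ) * τ))) (grad v)) + inner ℝ ρ (grad v) := by
    intro n
    by_cases hn : n < N
    · have h1 : ((n + 1 : ℕ) : ℝ) * τ - n * τ = τ := by push_cast; ring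
      have h2 : ((n + 1 : ℕ) : ℝ) * τ ≤ T := le_trans (by gcongr; exact hn) hN
      obtain ⟨ρ, hρ, hρv⟩ := exists_consistency_flux hc hY hU (s := n * τ)
        (t := (n + 1 : ℕ) * τ) (by positivity) (by linarith) h2
      rw [h1] at hρ hρv
      exact ⟨ρ, fun _ => ⟨hρ, hρv⟩⟩
    · exact ⟨0, fun h => absurd h hn⟩
  choose ρ hρ using hex
  let ζ : ℕ → H := fun n => grad (Y ((n + 1 : ℕ) * τ)) - grad (w (n + 1))
  -- The flux accumulates consistency fluxes minus the scaled gradients of the potential errors, so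
  -- the flux identity follows by induction.
  let G : ℕ → H := fun n => ∑ i ∈ Finset.range n, (ρ i - (τ * c) • ζ i)
  have hG : ∀ n, G (n + 1) = G n + (ρ n - (τ * c) • ζ n) := fun n => Finset.sum_range_succ _ n
  refine ⟨G, by simp [G], fun n => ?_, fun n hn => ?_⟩
  · induction n with
    | zero => intro _ v; simp [G, h0]
    | succ n ih =>
      intro hn v
      have h1 := ih (Nat.le_of_succ_le hn) v
      have h2 := hu n hn v
      have h3 := (hρ n hn).2 v
      rw [inner_sub_left] at h1 ⊢
      rw [hG, inner_add_left, inner_sub_left, inner_smul_left, inner_sub_left]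
      simp only [conj_trivial]
      linarith
  · have h1 : (τ * c) • ζ n = ρ n - (G (n + 1) - G n) := by rw [hG]; abel
    have h2 : τ * c * inner ℝ (G (n + 1)) (ζ n) =
        inner ℝ (G (n + 1)) (ρ n) - inner ℝ (G (n + 1)) (G (n + 1) - G n) := by
      rw [← inner_sub_right, ← h1, inner_smul_right]
    have h3 := half_sub_le_inner (G (n + 1)) (G n)
    have h4 : inner ℝ (G (n + 1)) (ρ n) ≤ ‖G (n + 1)‖ * (c * L * τ ^ 2) :=
      (real_inner_le_norm _ _).trans (by gcongr; exact (hρ n hn).1)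
    change τ * c * inner ℝ (G (n + 1)) (ζ n) ≤ _
    linarith

end Flux

/-! ### First-order accuracy -/

section Accuracy

variable {d : ℕ} {M : Model d}

/-- The error equation for one step, tested with the error. Here `u₀, p₀` is the old iterate and
`U, Y, P, R, Λ` the exact solution at the new time. -/
theorem Model.LiuWuStep.error_inequality (hM : M.Admissible) {L LΓ : ℝ≥0}
    (hL : LipschitzOnWith L (deriv M.Wm) M.J) (hLΓ : LipschitzOnWith LΓ (deriv M.WΓm) M.JΓ)
    {T t : ℝ} (ht : t ∈ Icc 0 T) {U Y : ℝ → H1Bulk M.Ω} {P R : ℝ → H1Surf M.Ω}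
    {Λ : ℝ → HMinusHalf M.Ω} (hsol : M.LiuWuSolution T U Y P R Λ)
    {τ : ℝ} {u₀ u₁ w₁ : H1Bulk M.Ω} {p₀ p₁ r₁ : H1Surf M.Ω} {l₁ : HMinusHalf M.Ω}
    (hs : M.LiuWuStep τ u₀ p₀ u₁ w₁ p₁ r₁ l₁) (h₀ : M.InRange u₀ p₀) (h₁ : M.InRange u₁ p₁) :
    M.ε * ‖bulkGrad (U t - u₁)‖ ^ 2 + M.δ * M.κ * ‖surfGrad (P t - p₁)‖ ^ 2 ≤
      M.ε⁻¹ * (L * ‖bulkVal (U t) - bulkVal u₀‖ * ‖bulkVal (U t - u₁)‖) +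
      M.δ⁻¹ * (LΓ * ‖surfVal (P t) - surfVal p₀‖ * ‖surfVal (P t - p₁)‖) +
      ipBulk (U t - u₁) (Y t - w₁) + ipSurf (P t - p₁) (R t - r₁) := by
  have htr : IsTrace (U t - u₁) (surfVal (P t - p₁)) := (hsol.eq_e t ht).sub hs.eq_e
  have hb := hs.eq_b _ ⟨_, htr.mem_HHalf⟩ htr
  have hd := hs.eq_d (P t - p₁) ⟨_, htr.mem_HHalf⟩ rfl
  have hb' := hsol.eq_b t ht _ ⟨_, htr.mem_HHalf⟩ htr
  have hd' := hsol.eq_d t ht (P t - p₁) ⟨_, htr.mem_HHalf⟩ rfl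
  have hr := hsol.inRange t ht
  have hW : -(L * ‖bulkVal (U t) - bulkVal u₀‖ * ‖bulkVal (U t - u₁)‖) ≤
      nlBulk (deriv M.W) (U t) (U t - u₁) -
      (nlBulk (deriv M.Wp) u₁ (U t - u₁) - nlBulk (deriv M.Wm) u₀ (U t - u₁)) :=
    hM.splitting.neg_le_integral_error hL (bulkVal (U t)) (bulkVal u₀) (bulkVal u₁)
      hr.1 h₀.1 h₁.1 (hsol.dual t ht (U t - u₁)) (hs.dual_plus (U t - u₁))
      (hs.dual_minus (U t - u₁))
  have hWΓ : -(LΓ * ‖surfVal (P t) - surfVal p₀‖ * ‖surfVal (P t - p₁)‖) ≤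
      nlSurf (deriv M.WΓ) (P t) (P t - p₁) -
      (nlSurf (deriv M.WΓp) p₁ (P t - p₁) - nlSurf (deriv M.WΓm) p₀ (P t - p₁)) :=
    hM.splittingΓ.neg_le_integral_error hLΓ (surfVal (P t)) (surfVal p₀) (surfVal p₁)
      hr.2 h₀.2 h₁.2 (hsol.dualΓ t ht (P t - p₁)) (hs.dualΓ_plus (P t - p₁))
      (hs.dualΓ_minus (P t - p₁))
  have hK : M.ε * ‖bulkGrad (U t - u₁)‖ ^ 2 =
      M.ε * (KBulk (U t) (U t - u₁) - KBulk u₁ (U t - u₁)) :=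
    congrArg (M.ε * ·) ((KBulk_self _).symm.trans (KBulk_sub_left (U t) u₁ (U t - u₁)))
  have hKΓ : M.δ * M.κ * ‖surfGrad (P t - p₁)‖ ^ 2 =
      M.δ * M.κ * (KSurf (P t) (P t - p₁) - KSurf p₁ (P t - p₁)) :=
    congrArg (M.δ * M.κ * ·) ((KSurf_self _).symm.trans (KSurf_sub_left (P t) p₁ (P t - p₁)))
  have hw := (ipBulk_comm (U t - u₁) (Y t - w₁)).trans (ipBulk_sub_left (Y t) w₁ (U t - u₁))
  have hwΓ := (ipSurf_comm (P t - p₁) (R t - r₁)).trans (ipSurf_sub_left (R t) r₁ (P t - p₁))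
  have g3 := mul_le_mul_of_nonneg_left hW (inv_nonneg.2 hM.ε_pos.le)
  have g4 := mul_le_mul_of_nonneg_left hWΓ (inv_nonneg.2 hM.δ_pos.le)
  linarith

/-- Flux form of the errors, and the interpolation and stability inequalities that they satisfy. -/
theorem exists_error_fluxes (hM : M.Admissible) {L LΓ : ℝ≥0}
    (hL : LipschitzOnWith L (deriv M.Wm) M.J) (hLΓ : LipschitzOnWith LΓ (deriv M.WΓm) M.JΓ)
    {T : ℝ} {U Y : ℝ → H1Bulk M.Ω} {P R : ℝ → H1Surf M.Ω}
    {Λ : ℝ → HMinusHalf M.Ω} (hsol : M.LiuWuSolution T U Y P R Λ) {S : ℝ≥0}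
    (hU : LipschitzOnWith S (fun t => bulkVal (U t)) (Icc 0 T))
    (hP : LipschitzOnWith S (fun t => surfVal (P t)) (Icc 0 T))
    (hY : LipschitzOnWith S Y (Icc 0 T)) (hR : LipschitzOnWith S R (Icc 0 T))
    {τ : ℝ} (hτ : 0 < τ) {N : ℕ} (hN : N * τ ≤ T)
    {u w : ℕ → H1Bulk M.Ω} {p r : ℕ → H1Surf M.Ω} {l : ℕ → HMinusHalf M.Ω}
    (hu0 : u 0 = U 0) (hp0 : p 0 = P 0) (hrange : ∀ n ≤ N, M.InRange (u n) (p n))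
    (hstep : ∀ n < N, M.LiuWuStep τ (u n) (p n) (u (n + 1)) (w (n + 1)) (p (n + 1)) (r (n + 1))
      (l (n + 1))) :
    ∃ (G : ℕ → Lp (EuclideanSpace ℝ (Fin d)) 2 (volume.restrict M.Ω))
      (GΓ : ℕ → Lp (EuclideanSpace ℝ (Fin d)) 2 (surfaceMeasure M.Ω)), G 0 = 0 ∧ GΓ 0 = 0 ∧
      (∀ n ≤ N, ∀ v, ipBulk (U (n * τ) - u n) v = inner ℝ (G n) (bulkGrad v)) ∧
      (∀ n ≤ N, ∀ q, ipSurf (P (n * τ) - p n) q = inner ℝ (GΓ n) (surfGrad q)) ∧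
      ∀ n < N,
        (M.σ⁻¹ * ‖G (n + 1)‖ ^ 2 + ‖GΓ (n + 1)‖ ^ 2) / 2 +
          τ * (M.ε * ‖bulkGrad (U ((n + 1 : ℕ) * τ) - u (n + 1))‖ ^ 2 +
            M.δ * M.κ * ‖surfGrad (P ((n + 1 : ℕ) * τ) - p (n + 1))‖ ^ 2) ≤
        (M.σ⁻¹ * ‖G n‖ ^ 2 + ‖GΓ n‖ ^ 2) / 2 +
          τ * (M.ε⁻¹ * (L * (S * τ + ‖bulkVal (U (n * τ) - u n)‖) *
              ‖bulkVal (U ((n + 1 : ℕ) * τ) - u (n + 1))‖) +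
            M.δ⁻¹ * (LΓ * (S * τ + ‖surfVal (P (n * τ) - p n)‖) *
              ‖surfVal (P ((n + 1 : ℕ) * τ) - p (n + 1))‖) +
            S * τ * (‖G (n + 1)‖ + ‖GΓ (n + 1)‖)) := by
  have hYg : LipschitzOnWith S (fun t => bulkGrad (Y t)) (Icc 0 T) :=
    LipschitzOnWith.of_dist_le_mul fun s hs t ht => (dist_eq_norm _ _).trans_le
      ((norm_bulkGrad_le (Y s - Y t)).trans (dist_eq_norm (Y s) (Y t) ▸ hY.dist_le_mul s hs t ht))
  have hRg : LipschitzOnWith S (fun t => surfGrad (R t)) (Icc 0 T) :=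
    LipschitzOnWith.of_dist_le_mul fun s hs t ht => (dist_eq_norm _ _).trans_le
      ((norm_surfGrad_le (R s - R t)).trans (dist_eq_norm (R s) (R t) ▸ hR.dist_le_mul s hs t ht))
  -- The abstract flux lemma is applied with `c = σ` in the bulk and `c = 1` on the surface.
  obtain ⟨G, hG0, hGv, hGn⟩ := exists_error_flux (val := bulkVal) (grad := bulkGrad)
    hM.σ_pos.le hYg (U := U)
    (by simpa only [ipBulk_eq_inner, KBulk_eq_inner] using hsol.eq_a) hτ hN (w := w) hu0
    (fun n hn v => by
      simpa only [ipBulk_eq_inner, KBulk_eq_inner] using (hstep n hn).eq_a v)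
  obtain ⟨GΓ, hGΓ0, hGΓv, hGΓn⟩ := exists_error_flux (val := surfVal) (grad := surfGrad)
    zero_le_one hRg (U := P)
    (by simpa only [ipSurf_eq_inner, KSurf_eq_inner, one_mul] using hsol.eq_c) hτ hN (w := r) hp0
    (fun n hn v => by
      simpa only [ipSurf_eq_inner, KSurf_eq_inner, mul_one] using (hstep n hn).eq_c v)
  have hGv' : ∀ n ≤ N, ∀ v, ipBulk (U (n * τ) - u n) v = inner ℝ (G n) (bulkGrad v) :=
    fun n hn v => (ipBulk_eq_inner _ _).trans (hGv n hn v)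
  have hGΓv' : ∀ n ≤ N, ∀ q, ipSurf (P (n * τ) - p n) q = inner ℝ (GΓ n) (surfGrad q) :=
    fun n hn v => (ipSurf_eq_inner _ _).trans (hGΓv n hn v)
  refine ⟨G, GΓ, hG0, hGΓ0, hGv', hGΓv', fun n hn => ?_⟩
  have hmem : ∀ m ≤ N, (m : ℝ) * τ ∈ Icc 0 T := fun m hm =>
    ⟨by positivity, le_trans (by gcongr) hN⟩
  have hdt : dist (((n + 1 : ℕ) : ℝ) * τ) (n * τ) = τ := by
    rw [Real.dist_eq]
    push_cast
    rw [show ((n : ℝ) + 1) * τ - n * τ = τ by ring, abs_of_pos hτ]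
  have hE := (hstep n hn).error_inequality hM hL hLΓ (hmem (n + 1) hn) hsol (hrange n hn.le)
    (hrange (n + 1) hn)
  have hw : _ = inner ℝ (G (n + 1)) (bulkGrad (Y ((n + 1 : ℕ) * τ)) - bulkGrad (w (n + 1))) :=
    hGv' (n + 1) hn (Y ((n + 1 : ℕ) * τ) - w (n + 1))
  have hwΓ : _ = inner ℝ (GΓ (n + 1)) (surfGrad (R ((n + 1 : ℕ) * τ)) - surfGrad (r (n + 1))) :=
    hGΓv' (n + 1) hn (R ((n + 1 : ℕ) * τ) - r (n + 1))
  rw [hw, hwΓ] at hE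
  -- The concave term is explicit, so the new exact value meets the old iterate: one time increment
  -- plus the old error.
  have hUt : ‖bulkVal (U ((n + 1 : ℕ) * τ)) - bulkVal (u n)‖ ≤
      S * τ + ‖bulkVal (U (n * τ) - u n)‖ := by
    have h1 := hU.dist_le_mul _ (hmem (n + 1) hn) _ (hmem n hn.le)
    rw [hdt] at h1
    have h2 := dist_triangle (bulkVal (U ((n + 1 : ℕ) * τ))) (bulkVal (U (n * τ))) (bulkVal (u n))
    exact (dist_eq_norm _ _).symm.trans_le
      (h2.trans (add_le_add h1 (dist_eq_norm (bulkVal (U (n * τ))) (bulkVal (u n))).le))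
  have hPt : ‖surfVal (P ((n + 1 : ℕ) * τ)) - surfVal (p n)‖ ≤
      S * τ + ‖surfVal (P (n * τ) - p n)‖ := by
    have h1 := hP.dist_le_mul _ (hmem (n + 1) hn) _ (hmem n hn.le)
    rw [hdt] at h1
    have h2 := dist_triangle (surfVal (P ((n + 1 : ℕ) * τ))) (surfVal (P (n * τ))) (surfVal (p n))
    exact (dist_eq_norm _ _).symm.trans_le
      (h2.trans (add_le_add h1 (dist_eq_norm (surfVal (P (n * τ))) (surfVal (p n))).le))
  have hε := hM.ε_pos
  have hδ := hM.δ_pos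
  have hσ := hM.σ_pos
  have g1 : M.ε⁻¹ * (L * ‖bulkVal (U ((n + 1 : ℕ) * τ)) - bulkVal (u n)‖ *
      ‖bulkVal (U ((n + 1 : ℕ) * τ) - u (n + 1))‖) ≤ M.ε⁻¹ * (L *
      (S * τ + ‖bulkVal (U (n * τ) - u n)‖) * ‖bulkVal (U ((n + 1 : ℕ) * τ) - u (n + 1))‖) := by
    gcongr
  have g2 : M.δ⁻¹ * (LΓ * ‖surfVal (P ((n + 1 : ℕ) * τ)) - surfVal (p n)‖ *
      ‖surfVal (P ((n + 1 : ℕ) * τ) - p (n + 1))‖) ≤ M.δ⁻¹ * (LΓ *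
      (S * τ + ‖surfVal (P (n * τ) - p n)‖) * ‖surfVal (P ((n + 1 : ℕ) * τ) - p (n + 1))‖) := by
    gcongr
  -- Division by `σ` matches the coefficient of the potential pairing in the error inequality,
  -- whence the weight `σ⁻¹` on the bulk flux.
  have g3 := mul_le_mul_of_nonneg_left (hGn n hn) (inv_nonneg.2 hσ.le)
  have g4 := hGΓn n hn
  have g5 := mul_le_mul_of_nonneg_left (hE.trans (add_le_add_left (add_le_add_left
    (add_le_add g1 g2) _) _)) hτ.le
  have e1 : ∀ x : ℝ, M.σ⁻¹ * (τ * M.σ * x) = τ * x := fun x => by field_simp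
  have e2 : ∀ x y : ℝ, M.σ⁻¹ * (x + M.σ * S * τ ^ 2 * y) = M.σ⁻¹ * x + S * τ ^ 2 * y :=
    fun x y => by field_simp
  rw [e1, e2] at g3
  linarith

/-- Interpolation of the `L²` error between flux and gradient, for bulk and surface together:
Cauchy–Schwarz in each space, then in the plane. -/
theorem sq_add_le_of_inner {X X' H H' : Type*} [NormedAddCommGroup X] [InnerProductSpace ℝ X]
    [NormedAddCommGroup X'] [InnerProductSpace ℝ X'] [NormedAddCommGroup H]
    [InnerProductSpace ℝ H] [NormedAddCommGroup H'] [InnerProductSpace ℝ H']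
    {x : X} {x' : X'} {G g : H} {G' g' : H'} (h : inner ℝ x x = inner ℝ G g)
    (h' : inner ℝ x' x' = inner ℝ G' g') :
    (‖x‖ ^ 2 + ‖x'‖ ^ 2) ^ 2 ≤ (‖G‖ ^ 2 + ‖G'‖ ^ 2) * (‖g‖ ^ 2 + ‖g'‖ ^ 2) := by
  rw [real_inner_self_eq_norm_sq] at h h'
  have h1 : ‖x‖ ^ 2 + ‖x'‖ ^ 2 ≤ ‖G‖ * ‖g‖ + ‖G'‖ * ‖g'‖ := by
    rw [h, h']
    exact add_le_add (real_inner_le_norm _ _) (real_inner_le_norm _ _)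
  calc _ ≤ (‖G‖ * ‖g‖ + ‖G'‖ * ‖g'‖) ^ 2 := by gcongr
    _ ≤ _ := by nlinarith [sq_nonneg (‖G‖ * ‖g'‖ - ‖G'‖ * ‖g‖)]

theorem add_le_of_weighted {α β x y : ℝ} (hα : 0 < α) (hβ : 0 < β) (hx : 0 ≤ x) (hy : 0 ≤ y) :
    x + y ≤ (α⁻¹ + β⁻¹) * (α * x + β * y) := by
  have h1 : (α⁻¹ + β⁻¹) * (α * x + β * y) = x + y + α⁻¹ * β * y + β⁻¹ * α * x := by
    field_simp
    ring
  have h2 : 0 ≤ α⁻¹ * β * y := by positivity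
  have h3 : 0 ≤ β⁻¹ * α * x := by positivity
  linarith

theorem le_sqrt_mul_sqrt {σ a x : ℝ} (hσ : 0 < σ) (h : σ⁻¹ * x ^ 2 ≤ a) : x ≤ √σ * √a := by
  rw [← Real.sqrt_mul hσ.le]
  refine Real.le_sqrt_of_sq_le ?_
  rwa [inv_mul_le_iff₀ hσ] at h

set_option maxHeartbeats 1000000 in
/-- The energy argument: errors in flux form that satisfy the stability inequality are of first
order in the step size. -/
theorem Model.Admissible.exists_bound_of_fluxes (hM : M.Admissible) (L LΓ S : ℝ≥0) {T : ℝ}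
    (hT : 0 < T) : ∃ C : ℝ, ∀ (τ : ℝ), 0 < τ → ∀ N : ℕ, N * τ ≤ T →
      ∀ (E : ℕ → H1Bulk M.Ω) (F : ℕ → H1Surf M.Ω)
        (G : ℕ → Lp (EuclideanSpace ℝ (Fin d)) 2 (volume.restrict M.Ω))
        (GΓ : ℕ → Lp (EuclideanSpace ℝ (Fin d)) 2 (surfaceMeasure M.Ω)),
        E 0 = 0 → F 0 = 0 → G 0 = 0 → GΓ 0 = 0 →
        (∀ n ≤ N, ∀ v, ipBulk (E n) v = inner ℝ (G n) (bulkGrad v)) →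
        (∀ n ≤ N, ∀ q, ipSurf (F n) q = inner ℝ (GΓ n) (surfGrad q)) →
        (∀ n < N,
          (M.σ⁻¹ * ‖G (n + 1)‖ ^ 2 + ‖GΓ (n + 1)‖ ^ 2) / 2 +
            τ * (M.ε * ‖bulkGrad (E (n + 1))‖ ^ 2 + M.δ * M.κ * ‖surfGrad (F (n + 1))‖ ^ 2) ≤
          (M.σ⁻¹ * ‖G n‖ ^ 2 + ‖GΓ n‖ ^ 2) / 2 +
            τ * (M.ε⁻¹ * (L * (S * τ + ‖bulkVal (E n)‖) * ‖bulkVal (E (n + 1))‖) +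
              M.δ⁻¹ * (LΓ * (S * τ + ‖surfVal (F n)‖) * ‖surfVal (F (n + 1))‖) +
              S * τ * (‖G (n + 1)‖ + ‖GΓ (n + 1)‖))) →
        √(τ * ∑ n ∈ Finset.Icc 1 N, (‖E n‖ ^ 2 + ‖F n‖ ^ 2)) ≤ C * τ ∧
        ∀ n ≤ N, (∀ v : H1Bulk M.Ω, |ipBulk (E n) v| ≤ C * τ * ‖v‖) ∧
          ∀ q : H1Surf M.Ω, |ipSurf (F n) q| ≤ C * τ * ‖q‖ := by
  have hε := hM.ε_pos
  have hδ := hM.δ_pos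
  have hκ := hM.κ_pos
  have hσ := hM.σ_pos
  obtain ⟨m, hm⟩ : ∃ m : ℝ, m = M.ε⁻¹ + (M.δ * M.κ)⁻¹ := ⟨_, rfl⟩
  obtain ⟨m', hm'⟩ : ∃ m' : ℝ, m' = M.σ⁻¹⁻¹ + 1⁻¹ := ⟨_, rfl⟩
  have hm0 : 0 < m := by rw [hm]; positivity
  have hm0' : 0 < m' := by rw [hm']; positivity
  set c : ℝ := m' * m with hc
  have hc0 : 0 < c := by positivity
  -- The factor 2 clears the halves in the stability inequality; the added 1 keeps `B` positive when
  -- the Lipschitz constants vanish.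
  set B : ℝ := 2 * (M.ε⁻¹ * L * (S + 1) + M.δ⁻¹ * LΓ * (S + 1) + S * (√M.σ + 1)) + 1 with hB
  obtain ⟨K, hK, hgron⟩ := exists_gronwall_bound hc0.le (C := B) (by positivity) hT
  -- The first summand serves the `H¹` errors, the second the dual norms, where `‖G n‖ ≤ √σ √(a n)`
  -- and `‖GΓ n‖ ≤ √(a n)`.
  refine ⟨√((1 + m + c / 4 * T) * K) + (√M.σ + 1) * √K, ?_⟩
  intro τ hτ N hN E F G GΓ hE0 hF0 hG0 hGΓ0 hG hGΓ hineq
  obtain ⟨a, ha⟩ : ∃ a : ℕ → ℝ, ∀ n, a n = M.σ⁻¹ * ‖G n‖ ^ 2 + ‖GΓ n‖ ^ 2 := ⟨_, fun _ => rfl⟩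
  obtain ⟨b, hb⟩ : ∃ b : ℕ → ℝ, ∀ n, b n =
    M.ε * ‖bulkGrad (E n)‖ ^ 2 + M.δ * M.κ * ‖surfGrad (F n)‖ ^ 2 := ⟨_, fun _ => rfl⟩
  obtain ⟨s, hs⟩ : ∃ s : ℕ → ℝ, ∀ n, s n = √(‖bulkVal (E n)‖ ^ 2 + ‖surfVal (F n)‖ ^ 2) :=
    ⟨_, fun _ => rfl⟩
  have ha0 : ∀ n, 0 ≤ a n := fun n => (ha n).symm ▸ by positivity
  have hb0 : ∀ n, 0 ≤ b n := fun n => (hb n).symm ▸ by positivity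
  have hs0 : ∀ n, 0 ≤ s n := fun n => (hs n).symm ▸ Real.sqrt_nonneg _
  have hs2 : ∀ n, s n ^ 2 = ‖bulkVal (E n)‖ ^ 2 + ‖surfVal (F n)‖ ^ 2 := fun n =>
    (congrArg (· ^ 2) (hs n)).trans (Real.sq_sqrt (by positivity))
  have hsb : ∀ n, ‖bulkVal (E n)‖ ≤ s n := fun n =>
    (Real.le_sqrt_of_sq_le (le_add_of_nonneg_right (sq_nonneg _))).trans_eq (hs n).symm
  have hss : ∀ n, ‖surfVal (F n)‖ ≤ s n := fun n =>
    (Real.le_sqrt_of_sq_le (le_add_of_nonneg_left (sq_nonneg _))).trans_eq (hs n).symm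
  have hgrad : ∀ n, ‖bulkGrad (E n)‖ ^ 2 + ‖surfGrad (F n)‖ ^ 2 ≤ m * b n := fun n => by
    rw [hm, hb n]
    exact add_le_of_weighted hε (mul_pos hδ hκ) (sq_nonneg _) (sq_nonneg _)
  have hflux : ∀ n, ‖G n‖ ^ 2 + ‖GΓ n‖ ^ 2 ≤ m' * a n := fun n => by
    rw [hm', ha n]
    simpa only [one_mul] using
      add_le_of_weighted (inv_pos.2 hσ) one_pos (sq_nonneg ‖G n‖) (sq_nonneg ‖GΓ n‖)
  have hinterp : ∀ n ≤ N, (s n ^ 2) ^ 2 ≤ c * a n * b n := fun n hn => by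
    rw [hs2 n]
    refine (sq_add_le_of_inner ((ipBulk_eq_inner _ _).symm.trans (hG n hn (E n)))
      ((ipSurf_eq_inner _ _).symm.trans (hGΓ n hn (F n)))).trans ?_
    calc _ ≤ (m' * a n) * (m * b n) := by
          have := ha0 n
          gcongr
          · exact hflux n
          · exact hgrad n
      _ = _ := by rw [hc]; ring
  have hGa : ∀ n, ‖G n‖ ≤ √M.σ * √(a n) := fun n =>
    le_sqrt_mul_sqrt hσ ((ha n).symm ▸ le_add_of_nonneg_right (sq_nonneg _))
  have hGΓa : ∀ n, ‖GΓ n‖ ≤ √(a n) := fun n =>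
    Real.le_sqrt_of_sq_le ((ha n).symm ▸ le_add_of_nonneg_left (by positivity))
  have hrec : ∀ n < N, a (n + 1) + τ * b (n + 1) ≤
      a n + B * τ * ((τ + s n) * s (n + 1) + τ * √(a (n + 1))) := by
    intro n hn
    have h1 := hineq n hn
    have e1 : M.ε⁻¹ * (L * (S * τ + ‖bulkVal (E n)‖) * ‖bulkVal (E (n + 1))‖) ≤
        M.ε⁻¹ * L * (S + 1) * ((τ + s n) * s (n + 1)) := by
      have h2 : S * τ + ‖bulkVal (E n)‖ ≤ (S + 1) * (τ + s n) := by
        linarith [hsb n, hs0 n, mul_nonneg S.coe_nonneg (hs0 n)]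
      calc _ ≤ M.ε⁻¹ * (L * ((S + 1) * (τ + s n)) * s (n + 1)) := by
            have := hsb (n + 1)
            have := add_nonneg hτ.le (hs0 n)
            gcongr
        _ = _ := by ring
    have e2 : M.δ⁻¹ * (LΓ * (S * τ + ‖surfVal (F n)‖) * ‖surfVal (F (n + 1))‖) ≤
        M.δ⁻¹ * LΓ * (S + 1) * ((τ + s n) * s (n + 1)) := by
      have h2 : S * τ + ‖surfVal (F n)‖ ≤ (S + 1) * (τ + s n) := by
        linarith [hss n, hs0 n, mul_nonneg S.coe_nonneg (hs0 n)]
      calc _ ≤ M.δ⁻¹ * (LΓ * ((S + 1) * (τ + s n)) * s (n + 1)) := by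
            have := hss (n + 1)
            have := add_nonneg hτ.le (hs0 n)
            gcongr
        _ = _ := by ring
    have e3 : S * τ * (‖G (n + 1)‖ + ‖GΓ (n + 1)‖) ≤ S * (√M.σ + 1) * (τ * √(a (n + 1))) := by
      calc _ ≤ S * τ * (√M.σ * √(a (n + 1)) + √(a (n + 1))) := by
            have := hGa (n + 1)
            have := hGΓa (n + 1)
            gcongr
        _ = _ := by ring
    have f1 : 0 ≤ (τ + s n) * s (n + 1) := mul_nonneg (add_nonneg hτ.le (hs0 n)) (hs0 _)
    have f2 : 0 ≤ τ * √(a (n + 1)) := by positivity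
    have k1 : 0 ≤ M.ε⁻¹ * L * (S + 1) := by positivity
    have k2 : 0 ≤ M.δ⁻¹ * LΓ * (S + 1) := by positivity
    have k3 : 0 ≤ S * (√M.σ + 1) := by positivity
    have e4 : 2 * (M.ε⁻¹ * (L * (S * τ + ‖bulkVal (E n)‖) * ‖bulkVal (E (n + 1))‖) +
        M.δ⁻¹ * (LΓ * (S * τ + ‖surfVal (F n)‖) * ‖surfVal (F (n + 1))‖) +
        S * τ * (‖G (n + 1)‖ + ‖GΓ (n + 1)‖)) ≤
        B * ((τ + s n) * s (n + 1) + τ * √(a (n + 1))) := by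
      rw [hB]
      linarith [mul_nonneg k1 f2, mul_nonneg k2 f2, mul_nonneg k3 f1]
    have e5 := mul_le_mul_of_nonneg_left e4 hτ.le
    have e6 := mul_nonneg hτ.le (hb0 (n + 1))
    rw [← ha (n + 1), ← hb (n + 1), ← ha n] at h1
    linarith
  have hfin := hgron τ hτ N hN a b s ha0 hb0 (by rw [ha 0, hG0, hGΓ0]; simp)
    (by
      have h1 : bulkGrad (0 : H1Bulk M.Ω) = 0 := rfl
      have h2 : surfGrad (0 : H1Surf M.Ω) = 0 := rfl
      rw [hb 0, hE0, hF0, h1, h2]; simp) hinterp hrec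
  have hsqrt : ∀ n ≤ N, √(a n) ≤ √K * τ := fun n hn => by
    rw [← Real.sqrt_sq hτ.le, ← Real.sqrt_mul hK]
    exact Real.sqrt_le_sqrt (hfin n hn).1
  have hC1 := Real.sqrt_nonneg ((1 + m + c / 4 * T) * K)
  have hC2 := Real.sqrt_nonneg K
  have hC3 := Real.sqrt_nonneg M.σ
  refine ⟨?_, fun n hn => ⟨fun v => ?_, fun q => ?_⟩⟩
  · have h1 : ∀ n ∈ Finset.Icc 1 N,
        ‖E n‖ ^ 2 + ‖F n‖ ^ 2 ≤ (1 + m) * b n + c / 4 * (K * τ ^ 2) := by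
      intro n hn
      have hn' := (Finset.mem_Icc.1 hn).2
      -- The `L²` part of the `H¹` norm is recovered by interpolation with `η = 1`; no Poincaré
      -- inequality is needed.
      have h2 := le_add_of_sq_le_mul (ha0 n) (hb0 n) hc0.le one_pos (hinterp n hn')
      have h3 := hgrad n
      have h4 : c / (4 * 1) * a n ≤ c / 4 * (K * τ ^ 2) := by
        rw [mul_one]
        gcongr
        exact (hfin n hn').1
      have h5 := hs2 n
      have h6 := norm_sq_bulk (E n)
      have h7 := norm_sq_surf (F n)
      linarith
    have h2 : τ * ∑ n ∈ Finset.Icc 1 N, (‖E n‖ ^ 2 + ‖F n‖ ^ 2) ≤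
        (1 + m + c / 4 * T) * K * τ ^ 2 := by
      calc _ ≤ τ * ∑ n ∈ Finset.Icc 1 N, ((1 + m) * b n + c / 4 * (K * τ ^ 2)) := by
            exact mul_le_mul_of_nonneg_left (Finset.sum_le_sum h1) hτ.le
        _ = (1 + m) * (τ * ∑ n ∈ Finset.Icc 1 N, b n) + N * τ * (c / 4 * (K * τ ^ 2)) := by
            rw [Finset.sum_add_distrib, ← Finset.mul_sum, Finset.sum_const, Nat.card_Icc,
              nsmul_eq_mul, Nat.add_sub_cancel]
            ring
        _ ≤ (1 + m) * (K * τ ^ 2) + T * (c / 4 * (K * τ ^ 2)) := by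
            have := (hfin N le_rfl).2
            gcongr
        _ = _ := by ring
    calc _ ≤ √((1 + m + c / 4 * T) * K * τ ^ 2) := Real.sqrt_le_sqrt h2
      _ = √((1 + m + c / 4 * T) * K) * τ := by
        rw [Real.sqrt_mul (by positivity), Real.sqrt_sq hτ.le]
      _ ≤ _ := by
        gcongr
        exact le_add_of_nonneg_right (by positivity)
  · rw [hG n hn v]
    calc _ ≤ ‖G n‖ * ‖bulkGrad v‖ := abs_real_inner_le_norm _ _
      _ ≤ (√M.σ * (√K * τ)) * ‖v‖ := by
        gcongr
        · exact (hGa n).trans (by gcongr; exact hsqrt n hn)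
        · exact norm_bulkGrad_le v
      _ ≤ _ := by
        rw [← mul_assoc]
        gcongr
        linarith
  · rw [hGΓ n hn q]
    calc _ ≤ ‖GΓ n‖ * ‖surfGrad q‖ := abs_real_inner_le_norm _ _
      _ ≤ (√K * τ) * ‖q‖ := by
        gcongr
        · exact (hGΓa n).trans (hsqrt n hn)
        · exact norm_surfGrad_le q
      _ ≤ _ := by
        gcongr
        linarith [mul_nonneg hC3 hC2]

theorem Model.Admissible.exists_error_bound (hM : M.Admissible) {L LΓ : ℝ≥0}
    (hL : LipschitzOnWith L (deriv M.Wm) M.J) (hLΓ : LipschitzOnWith LΓ (deriv M.WΓm) M.JΓ)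
    {T : ℝ} (hT : 0 < T) {U Y : ℝ → H1Bulk M.Ω} {P R : ℝ → H1Surf M.Ω}
    {Λ : ℝ → HMinusHalf M.Ω} (hsol : M.LiuWuSolution T U Y P R Λ)
    (hLip : M.LipschitzInTime T U Y P R) :
    ∃ C : ℝ, ∀ (τ : ℝ), 0 < τ → ∀ N : ℕ, N * τ ≤ T →
      ∀ (u w : ℕ → H1Bulk M.Ω) (p r : ℕ → H1Surf M.Ω) (l : ℕ → HMinusHalf M.Ω),
        u 0 = U 0 → p 0 = P 0 →
        (∀ n ≤ N, M.InRange (u n) (p n)) →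
        (∀ n < N, M.LiuWuStep τ (u n) (p n) (u (n + 1)) (w (n + 1)) (p (n + 1)) (r (n + 1))
          (l (n + 1))) →
        √(τ * ∑ n ∈ Finset.Icc 1 N,
          (‖U (n * τ) - u n‖ ^ 2 + ‖P (n * τ) - p n‖ ^ 2)) ≤ C * τ ∧
        ∀ n ≤ N, (∀ v : H1Bulk M.Ω, |ipBulk (U (n * τ) - u n) v| ≤ C * τ * ‖v‖) ∧
          ∀ q : H1Surf M.Ω, |ipSurf (P (n * τ) - p n) q| ≤ C * τ * ‖q‖ := by
  obtain ⟨S, hU, hP, hY, hR⟩ := hLip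
  obtain ⟨C, hC⟩ := hM.exists_bound_of_fluxes L LΓ S hT
  refine ⟨C, fun τ hτ N hN u w p r l hu0 hp0 hrange hstep => ?_⟩
  obtain ⟨G, GΓ, hG0, hGΓ0, hG, hGΓ, hineq⟩ := exists_error_fluxes hM hL hLΓ hsol hU hP hY hR hτ hN
    hu0 hp0 hrange hstep
  exact hC τ hτ N hN (fun n => U (n * τ) - u n) (fun n => P (n * τ) - p n) G GΓ
    (by simp [hu0]) (by simp [hp0]) hG0 hGΓ0 hG hGΓ hineq

end Accuracy

end CahnHilliard

end

theorem proposition3p2 {d : ℕ} (hd : d = 2 ∨ d = 3) (M : Model d) (hM : M.Admissible) :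
    -- energy dissipation
    (∀ (τ : ℝ), 0 < τ →
      ∀ (u w : ℕ → H1Bulk M.Ω) (p r : ℕ → H1Surf M.Ω) (l : ℕ → HMinusHalf M.Ω),
        IsTrace (u 0) (surfVal (p 0)) →
        M.FiniteEnergy (u 0) (p 0) →
        (∀ n, M.InRange (u n) (p n)) →
        (∀ n, M.LiuWuStep τ (u n) (p n) (u (n + 1)) (w (n + 1)) (p (n + 1)) (r (n + 1))
          (l (n + 1))) →
        ∀ n, IsTrace (u n) (surfVal (p n)) ∧ M.FiniteEnergy (u n) (p n) ∧
          M.energy (u (n + 1)) (p (n + 1)) ≤ M.energy (u n) (p n)) ∧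
    -- first-order accuracy
    (∀ (L LΓ : ℝ≥0), LipschitzOnWith L (deriv M.Wm) M.J → LipschitzOnWith LΓ (deriv M.WΓm) M.JΓ →
      ∀ (T : ℝ), 0 < T →
      ∀ (U Y : ℝ → H1Bulk M.Ω) (P R : ℝ → H1Surf M.Ω) (Λ : ℝ → HMinusHalf M.Ω),
        M.LiuWuSolution T U Y P R Λ →
        M.LipschitzInTime T U Y P R →
        ∃ C : ℝ, ∀ (τ : ℝ), 0 < τ → ∀ N : ℕ, N * τ ≤ T →
          ∀ (u w : ℕ → H1Bulk M.Ω) (p r : ℕ → H1Surf M.Ω) (l : ℕ → HMinusHalf M.Ω),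
            u 0 = U 0 → p 0 = P 0 →
            (∀ n ≤ N, M.InRange (u n) (p n)) →
            (∀ n < N, M.LiuWuStep τ (u n) (p n) (u (n + 1)) (w (n + 1)) (p (n + 1)) (r (n + 1))
              (l (n + 1))) →
            -- error in `L²(0,T;H¹(Ω))` and `L²(0,T;H¹(Γ))`
            √(τ * ∑ n ∈ Finset.Icc 1 N,
              (‖U (n * τ) - u n‖ ^ 2 + ‖P (n * τ) - p n‖ ^ 2)) ≤ C * τ ∧
            -- error in `L^∞(0,T;H¹(Ω)*)` and `L^∞(0,T;H¹(Γ)*)`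
            ∀ n ≤ N, (∀ v : H1Bulk M.Ω, |ipBulk (U (n * τ) - u n) v| ≤ C * τ * ‖v‖) ∧
              ∀ q : H1Surf M.Ω, |ipSurf (P (n * τ) - p n) q| ≤ C * τ * ‖q‖) := by
  have hd0 : d ≠ 0 := by omega
  refine ⟨fun τ hτ u w p r l h0 hE0 hrange hstep => ?_, fun L LΓ hL hLΓ T hT U Y P R Λ hsol hLip =>
    hM.exists_error_bound hL hLΓ hT hsol hLip⟩
  have htr : ∀ n, IsTrace (u n) (surfVal (p n)) := fun n => by
    cases n with
    | zero => exact h0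
    | succ n => exact (hstep n).eq_e
  have hfin : ∀ n, M.FiniteEnergy (u n) (p n) := fun n => by
    induction n with
    | zero => exact hE0
    | succ n ih =>
      -- The dual condition at iterate `n + 1` is read off from the following step, which exists
      -- because the scheme runs for all `n`.
      exact (hstep n).finiteEnergy hd0 hM (hrange n) (hrange (n + 1)) ih
        (hstep (n + 1)).dual_minus (hstep (n + 1)).dualΓ_minus
  exact fun n => ⟨htr n, hfin n, (hstep n).energy_le hM hτ (hrange n) (hrange (n + 1)) (hfin n)
    (hfin (n + 1)) (htr n)⟩
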